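/- Let $F|k$ be an extension of algebraically closed fields of characteristic zero, of transcendence degree $n$ with $1\le n\le\infty$, where $n=\infty$ means countably infinite. Let $G=\mathrm{Aut}(F|k)$, with the topology for which the pointwise stabilizers of the finite subsets of $F$ form a base of neighbourhoods of $1$. A $G$-set (a $G$-group, a representation of $G$ over $\mathbb Q$, a $G$-torsor) is called smooth if the stabilizers of all its elements are open in $G$. (a) If $n=\infty$, then the union of the proper open subgroups of $G$ is a proper dense subset of $G$. (b) For every $\sigma\in G$ the following properties are equivalent: 1. $\sigma$ does not belong to the union of the proper open subgroups of $G$; 2. $W^{\langle\sigma\rangle}=W^G$ for every smooth $G$-set $W$; 3. $W^{\langle\sigma\rangle}=W^G$ for every smooth representation $W$ of $G$ over $\mathbb Q$; 4. for every integer $q\ge 1$, the space $\Omega^q_{F|k}=\bigwedge^q_F\Omega^1_{F|k}$ has no non-zero finite-dimensional $F$-vector subspace that is invariant under $\sigma$, where $\sigma(f\,dg_1\wedge\dots\wedge dg_q)=\sigma(f)\,d\sigma(g_1)\wedge\dots\wedge d\sigma(g_q)$; 5. $\Omega^1_{F|k}$ has no non-zero finite-dimensional $\sigma$-invariant $F$-vector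 subspace. (c) Suppose that $\sigma\in G$ has these equivalent properties, and let $M$ be a smooth $G$-group (a group, not necessarily commutative, with a smooth action of $G$ by automorphisms). For a group $H$ acting on $M$ by automorphisms, an $H$-torsor under $M$ is a non-empty set $T$ with a left action of $H$ and a simply transitive right action of $M$ such that $h(tm)=(ht)(hm)$; it is trivial if it is isomorphic to $M$ with its $H$-action and its right multiplication. Let $H^1(H,M)$ be the set of isomorphism classes of $H$-torsors under $M$, pointed by the class of the trivial torsor, and let $H^1_{Sm}(G,M)\subseteq H^1(G,M)$ be the subset of the classes of smooth $G$-torsors. Then the restriction to $\langle\sigma\rangle$ of every non-trivial smooth $G$-torsor under $M$ is non-trivial, i.e. the sequence of pointed sets $\{\ast\}\to H^1_{Sm}(G,M)\to H^1(\langle\sigma\rangle,M)$ is exact. Moreover, the restriction map $H^1_{Sm}(G,M)\to H^1(\langle\sigma\rangle,M)$ is injective, and it is not bijective if $M\ne\{1\}$ and $G$ acts trivially on $M$. -/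

import Mathlib

open scoped KaehlerDifferential

/-! ### The topological group of automorphisms of a field extension -/

/-- The group `G` of automorphisms of the field `F` over `k`. This is a copy of `F ≃ₐ[k] F`:
the latter carries in Mathlib the Krull topology, defined through *finite* subextensions, which is
not the topology wanted for a transcendental extension. -/
def FieldAut (k F : Type*) [Field k] [Field F] [Algebra k F] : Type _ := F ≃ₐ[k] F

namespace FieldAut

section Basic

variable {k F : Type*} [Field k] [Field F] [Algebra k F]

instance : Group (FieldAut k F) := inferInstanceAs (Group (F ≃ₐ[k] F))

instance : MulSemiringAction (FieldAut k F) F :=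
  inferInstanceAs (MulSemiringAction (F ≃ₐ[k] F) F)

instance : FaithfulSMul (FieldAut k F) F :=
  inferInstanceAs (FaithfulSMul (F ≃ₐ[k] F) F)

instance : SMulCommClass (FieldAut k F) k F :=
  inferInstanceAs (SMulCommClass (F ≃ₐ[k] F) k F)

/-- The topology with a base given by the left cosets `gU`, where `U` runs over the pointwise
stabilizers of the finite subsets of `F`. -/
instance : TopologicalSpace (FieldAut k F) where
  IsOpen U := ∀ g ∈ U, ∃ S : Finset F, ∀ h : FieldAut k F, (∀ x ∈ S, h • x = g • x) → h ∈ U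
  isOpen_univ := fun _ _ => ⟨∅, fun _ _ => trivial⟩
  isOpen_inter := by
    classical
    rintro U V hU hV g ⟨hgU, hgV⟩
    obtain ⟨S, hS⟩ := hU g hgU
    obtain ⟨T, hT⟩ := hV g hgV
    exact ⟨S ∪ T, fun h hh => ⟨hS h fun x hx => hh x (Finset.mem_union_left _ hx),
      hT h fun x hx => hh x (Finset.mem_union_right _ hx)⟩⟩
  isOpen_sUnion := by
    rintro 𝒰 h𝒰 g ⟨U, hU, hgU⟩
    obtain ⟨S, hS⟩ := h𝒰 U hU g hgU
    exact ⟨S, fun h hh => ⟨U, hU, hS h hh⟩⟩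

theorem isOpen_iff {U : Set (FieldAut k F)} :
    IsOpen U ↔ ∀ g ∈ U, ∃ S : Finset F, ∀ h : FieldAut k F, (∀ x ∈ S, h • x = g • x) → h ∈ U :=
  Iff.rfl

instance : IsTopologicalGroup (FieldAut k F) where
  continuous_mul := by
    classical
    rw [continuous_iff_continuousAt]
    rintro ⟨g, h⟩
    rw [ContinuousAt, tendsto_nhds]
    intro U hU hgh
    obtain ⟨S, hS⟩ := isOpen_iff.1 hU _ hgh
    rw [nhds_prod_eq]
    refine Filter.mem_of_superset (Filter.prod_mem_prod
      (s := {g' | ∀ x ∈ S.image (fun x => h • x), g' • x = g • x})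
      (t := {h' | ∀ x ∈ S, h' • x = h • x}) (IsOpen.mem_nhds ?_ ?_) (IsOpen.mem_nhds ?_ ?_)) ?_
    · exact isOpen_iff.2 fun a ha => ⟨_, fun b hb x hx => (hb x hx).trans (ha x hx)⟩
    · exact fun _ _ => rfl
    · exact isOpen_iff.2 fun a ha => ⟨_, fun b hb x hx => (hb x hx).trans (ha x hx)⟩
    · exact fun _ _ => rfl
    · rintro ⟨g', h'⟩ ⟨hg', hh'⟩
      refine hS _ fun x hx => ?_
      change (g' * h') • x = (g * h) • x
      rw [mul_smul, mul_smul, hh' x hx]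
      exact hg' _ (Finset.mem_image_of_mem _ hx)
  continuous_inv := by
    classical
    rw [continuous_def]
    intro U hU
    refine isOpen_iff.2 fun g hg => ?_
    obtain ⟨S, hS⟩ := isOpen_iff.1 hU _ hg
    refine ⟨S.image (fun x => g⁻¹ • x), fun h hh => hS _ fun x hx => ?_⟩
    have := hh _ (Finset.mem_image_of_mem _ hx)
    rw [smul_inv_smul] at this
    rw [inv_smul_eq_iff, this]

/-- A subgroup is open if and only if it contains the pointwise stabilizer of a finite set. -/
theorem isOpen_subgroup_iff (U : Subgroup (FieldAut k F)) :
    IsOpen (U : Set (FieldAut k F)) ↔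
      ∃ S : Finset F, ∀ h : FieldAut k F, (∀ x ∈ S, h • x = x) → h ∈ U := by
  refine ⟨fun hU => ?_, fun ⟨S, hS⟩ => isOpen_iff.2 fun g hg => ⟨S, fun h hh => ?_⟩⟩
  · obtain ⟨S, hS⟩ := isOpen_iff.1 hU 1 U.one_mem
    exact ⟨S, fun h hh => hS h fun x hx => by rw [hh x hx, one_smul]⟩
  · have : g⁻¹ * h ∈ U := hS _ fun x hx => by rw [mul_smul, hh x hx, inv_smul_smul]
    simpa using U.mul_mem hg this

/-- The union of the proper open subgroups of `G`. -/
def properOpenUnion (k F : Type*) [Field k] [Field F] [Algebra k F] : Set (FieldAut k F) :=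
  {σ | ∃ U : Subgroup (FieldAut k F), IsOpen (U : Set (FieldAut k F)) ∧ U ≠ ⊤ ∧ σ ∈ U}

end Basic

/-! ### The semilinear action on differential forms -/

section Forms

variable {k F : Type*} [Field k] [Field F] [Algebra k F]

/-- The abelian group `M` with `F` acting through the automorphism `σ`. -/
def Twist (_σ : FieldAut k F) (M : Type*) : Type _ := M

section Twist

variable (σ : FieldAut k F) (M : Type*) [AddCommGroup M] [Module F M]

instance : AddCommGroup (Twist σ M) := inferInstanceAs (AddCommGroup M)

instance : Module F (Twist σ M) :=
  Module.compHom M (MulSemiringAction.toRingHom (FieldAut k F) F σ)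

instance : Module k (Twist σ M) := Module.compHom (Twist σ M) (algebraMap k F)

instance : IsScalarTower k F (Twist σ M) where
  smul_assoc c f m := by
    change (c • f) • m = (algebraMap k F c) • (f • m)
    rw [Algebra.smul_def, mul_smul]

/-- The identity map `M → Twist σ M`. -/
def toTwist : M ≃+ Twist σ M := AddEquiv.refl M

variable {M}

theorem smul_toTwist (f : F) (m : M) : f • toTwist σ M m = toTwist σ M ((σ • f) • m) := rfl

theorem base_smul_toTwist (c : k) (m : M) :
    c • toTwist σ M m = toTwist σ M ((algebraMap k F c) • m) := by
  change (algebraMap k F c) • toTwist σ M m = _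
  rw [smul_toTwist, Algebra.algebraMap_eq_smul_one, smul_comm, smul_one]

end Twist

/-- The derivation `f ↦ d(σ f)`, with values in the twisted module of differentials. -/
noncomputable def twistedD (σ : FieldAut k F) : Derivation k F (Twist σ (Ω[F⁄k])) where
  toFun f := toTwist σ _ (KaehlerDifferential.D k F (σ • f))
  map_add' f g := by rw [smul_add, map_add, map_add]
  map_smul' c f := by
    rw [smul_comm, Derivation.map_smul, RingHom.id_apply, base_smul_toTwist, algebraMap_smul]
  map_one_eq_zero' := by
    change toTwist σ _ (KaehlerDifferential.D k F (σ • 1)) = 0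
    rw [smul_one, Derivation.map_one_eq_zero, map_zero]
  leibniz' f g := by
    change toTwist σ _ (KaehlerDifferential.D k F (σ • (f * g))) = _
    rw [smul_mul', Derivation.leibniz, map_add]
    rfl

/-- The action of `σ` on the differentials `Ω¹` of `F` over `k`: `f dg ↦ σ(f) d(σ(g))`. -/
noncomputable def actOnDifferentials (σ : FieldAut k F) : Ω[F⁄k] →+ Ω[F⁄k] :=
  (toTwist σ _).symm.toAddMonoidHom.comp
    (twistedD σ).liftKaehlerDifferential.toAddMonoidHom

theorem actOnDifferentials_smul (σ : FieldAut k F) (f : F) (ω : Ω[F⁄k]) :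
    actOnDifferentials σ (f • ω) = (σ • f) • actOnDifferentials σ ω := by
  change (toTwist σ _).symm ((twistedD σ).liftKaehlerDifferential (f • ω)) = _
  rw [map_smul]
  rfl

theorem actOnDifferentials_D (σ : FieldAut k F) (g : F) :
    actOnDifferentials σ (KaehlerDifferential.D k F g) = KaehlerDifferential.D k F (σ • g) := by
  change (toTwist σ _).symm ((twistedD σ).liftKaehlerDifferential (KaehlerDifferential.D k F g)) = _
  rw [Derivation.liftKaehlerDifferential_comp_D]
  rfl

/-- The alternating map `(ω₁, …, ω_q) ↦ σ(ω₁) ∧ … ∧ σ(ω_q)`, with values in a twisted module. -/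
noncomputable def twistedWedge (σ : FieldAut k F) (q : ℕ) :
    (Ω[F⁄k]) [⋀^Fin q]→ₗ[F] Twist σ (⋀[F]^q Ω[F⁄k]) where
  toFun v := toTwist σ _ (exteriorPower.ιMulti F q fun i => actOnDifferentials σ (v i))
  map_update_add' v i x y := by
    have h (z : Ω[F⁄k]) : (fun j => actOnDifferentials σ (Function.update v i z j)) =
        Function.update (fun j => actOnDifferentials σ (v j)) i (actOnDifferentials σ z) := by
      ext1 j
      rcases eq_or_ne j i with rfl | hj
      · simp
      · simp [hj]
    rw [h, h, h, map_add, AlternatingMap.map_update_add, map_add]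
  map_update_smul' v i c x := by
    have h (z : Ω[F⁄k]) : (fun j => actOnDifferentials σ (Function.update v i z j)) =
        Function.update (fun j => actOnDifferentials σ (v j)) i (actOnDifferentials σ z) := by
      ext1 j
      rcases eq_or_ne j i with rfl | hj
      · simp
      · simp [hj]
    rw [h, h, actOnDifferentials_smul, AlternatingMap.map_update_smul, smul_toTwist]
  map_eq_zero_of_eq' v i j hv hij := by
    change toTwist σ _ (exteriorPower.ιMulti F q fun i => actOnDifferentials σ (v i)) = 0
    rw [AlternatingMap.map_eq_zero_of_eq _ _ (by rw [hv]) hij, map_zero]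

/-- The action of `σ` on the `q`-forms `Ω^q` of `F` over `k`, the `q`-th exterior power over `F` of
`Ω¹`: `f dg₁ ∧ … ∧ dg_q ↦ σ(f) d(σ(g₁)) ∧ … ∧ d(σ(g_q))`. -/
noncomputable def actOnForms (σ : FieldAut k F) (q : ℕ) : ⋀[F]^q Ω[F⁄k] →+ ⋀[F]^q Ω[F⁄k] :=
  (toTwist σ _).symm.toAddMonoidHom.comp
    (exteriorPower.alternatingMapLinearEquiv (twistedWedge σ q)).toAddMonoidHom

theorem actOnForms_smul (σ : FieldAut k F) (q : ℕ) (f : F) (ω : ⋀[F]^q Ω[F⁄k]) :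
    actOnForms σ q (f • ω) = (σ • f) • actOnForms σ q ω := by
  change (toTwist σ _).symm
    (exteriorPower.alternatingMapLinearEquiv (twistedWedge σ q) (f • ω)) = _
  rw [map_smul]
  rfl

theorem actOnForms_ιMulti (σ : FieldAut k F) (q : ℕ) (v : Fin q → Ω[F⁄k]) :
    actOnForms σ q (exteriorPower.ιMulti F q v) =
      exteriorPower.ιMulti F q fun i => actOnDifferentials σ (v i) := by
  change (toTwist σ _).symm
    (exteriorPower.alternatingMapLinearEquiv (twistedWedge σ q) (exteriorPower.ιMulti F q v)) = _
  rw [exteriorPower.alternatingMapLinearEquiv_apply_ιMulti]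
  rfl

end Forms

end FieldAut

/-! ### Smooth actions -/

/-- An action of a topological group on a set is smooth if all stabilizers are open. -/
def IsSmoothAction (G W : Type*) [Group G] [TopologicalSpace G] [MulAction G W] : Prop :=
  ∀ w : W, IsOpen (MulAction.stabilizer G w : Set G)

/-- A linear representation of a topological group is smooth if all stabilizers are open. -/
def IsSmoothRep {E G W : Type*} [Field E] [Group G] [TopologicalSpace G] [AddCommGroup W]
    [Module E W] (ρ : Representation E G W) : Prop :=
  ∀ w : W, IsOpen {g : G | ρ g w = w}

/-! ### Torsors and non-abelian first cohomology -/

universe u v w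

/-- An `H`-torsor under the `H`-group `M` (a group on which `H` acts by automorphisms): a non-empty
set with a left action of `H` and a simply transitive right action of `M`, subject to
`h (t m) = (h t) (h m)`. As such a set is in bijection with `M`, it can be taken in the universe
of `M`. -/
structure GroupTorsor (H : Type v) (M : Type w) [Group H] [Group M] [MulDistribMulAction H M] where
  carrier : Type w
  [leftAction : MulAction H carrier]
  [rightAction : MulAction Mᵐᵒᵖ carrier]
  nonempty : Nonempty carrier
  smul_smul_op : ∀ (h : H) (t : carrier) (m : M),
    h • (MulOpposite.op m • t) = MulOpposite.op (h • m) • (h • t)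
  simplyTransitive : ∀ t t' : carrier, ∃! m : M, MulOpposite.op m • t = t'

namespace GroupTorsor

attribute [instance] GroupTorsor.leftAction GroupTorsor.rightAction

variable {H : Type v} {M : Type w} [Group H] [Group M] [MulDistribMulAction H M]

/-- Two torsors are isomorphic if there is a bijection commuting with both actions. -/
def IsIso (T T' : GroupTorsor H M) : Prop :=
  ∃ e : T.carrier ≃ T'.carrier, (∀ (h : H) (t : T.carrier), e (h • t) = h • e t) ∧
    ∀ (m : M) (t : T.carrier), e (MulOpposite.op m • t) = MulOpposite.op m • e t

variable (H M) in
/-- Isomorphism as an equivalence relation on torsors. -/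
instance isoSetoid : Setoid (GroupTorsor H M) where
  r := IsIso
  iseqv :=
    { refl := fun _ => ⟨Equiv.refl _, fun _ _ => rfl, fun _ _ => rfl⟩
      symm := fun ⟨e, h₁, h₂⟩ => ⟨e.symm,
        fun h t => by rw [Equiv.symm_apply_eq, h₁, Equiv.apply_symm_apply],
        fun m t => by rw [Equiv.symm_apply_eq, h₂, Equiv.apply_symm_apply]⟩
      trans := fun ⟨e, h₁, h₂⟩ ⟨e', h₁', h₂'⟩ => ⟨e.trans e',
        fun h t => by simp only [Equiv.trans_apply, h₁, h₁'],
        fun m t => by simp only [Equiv.trans_apply, h₂, h₂']⟩ }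

variable (H M) in
/-- The trivial torsor: `M` itself, with its given `H`-action and right multiplication. -/
def trivial : GroupTorsor H M where
  carrier := M
  nonempty := ⟨1⟩
  smul_smul_op h t m := by simp only [MulOpposite.smul_eq_mul_unop, MulOpposite.unop_op, smul_mul']
  simplyTransitive t t' := ⟨t⁻¹ * t', by simp, fun m hm => by
    rw [← hm]; simp⟩

/-- The restriction of a torsor to a subgroup of `H`. -/
def restrict (T : GroupTorsor H M) (K : Subgroup H) : GroupTorsor K M where
  carrier := T.carrier
  nonempty := T.nonempty
  smul_smul_op h t m := T.smul_smul_op (h : H) t m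
  simplyTransitive := T.simplyTransitive

/-- A torsor is smooth if its stabilizers in `H` are open. -/
def IsSmooth [TopologicalSpace H] (T : GroupTorsor H M) : Prop := IsSmoothAction H T.carrier

end GroupTorsor

section Cohomology

variable (H : Type v) (M : Type w) [Group H] [Group M] [MulDistribMulAction H M]

/-- `H¹(H, M)`, for `H` a group without topology: isomorphism classes of `H`-torsors under `M`. -/
def H1 : Type (max v (w + 1)) := Quotient (GroupTorsor.isoSetoid H M)

/-- The distinguished element of `H¹(H, M)`, the class of the trivial torsor. -/
def H1.base : H1 H M := Quotient.mk _ (GroupTorsor.trivial H M)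

/-- `H¹_Sm(H, M)`, for `H` a topological group: the isomorphism classes of smooth `H`-torsors
under `M`, as a subset of the set of isomorphism classes of all torsors. -/
def H1Sm [TopologicalSpace H] : Set (H1 H M) :=
  {c | ∃ T : GroupTorsor H M, T.IsSmooth ∧ Quotient.mk _ T = c}

variable {H} in
/-- The restriction map `H¹(H, M) → H¹(K, M)` for a subgroup `K` of `H`. -/
def H1.res (K : Subgroup H) : H1 H M → H1 K M :=
  Quotient.map (fun T => T.restrict K) fun _ _ ⟨e, h₁, h₂⟩ => ⟨e, fun h t => h₁ h t, h₂⟩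

end Cohomology

/-! Independence of finite subsets of `F` is measured by disjointness of the `F`-spans of their
differentials. In characteristic zero, over an algebraically closed `k`, disjoint spans make the
generated algebras linearly disjoint (`linearDisjoint_adjoin`). If the transcendence degree is `ℵ₀`,
the identity on one finite set and an automorphism on another then glue to a single automorphism,
provided the second set and its image are independent of the first (`exists_fixing_of_disjoint`).
Shifts of transcendence bases indexed by `ℤ` produce the required independence (`exists_shift`,
`exists_fixing_inf_le`).

The heart is `exists_invariant_of_isOpen`. Let an open subgroup `U` contain the pointwise stabilizer
of a finite set `S`. Among the intersections of the span of `dS` with the spans of `d(uS)`, `u ∈ U`,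
one of minimal dimension lies in every translate, so it extends to nothing smaller and is
`U`-invariant. If it vanishes, `U` contains the stabilizers of two independent sets, and these
generate the group (`eq_top_of_disjoint`). Conversely, a finite-dimensional space of forms of
positive degree has an open stabilizer, which is proper if the space is non-zero, since a power of a
shift moves the space off itself. The shift itself therefore lies in no proper open subgroup.

In finite degree a modular character with values in `ℚˣ` puts every automorphism into a proper open
subgroup, so the first condition forces degree `ℵ₀`. Smooth sets and representations are tested on
coset spaces `G ⧸ U` and their permutation representations.

For torsors, the automorphisms commuting with a given `⟨σ⟩`-isomorphism of smooth torsors form an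
open subgroup containing `σ`, hence the whole group. Surjectivity of restriction fails for trivial
coefficients because there is no proper open normal subgroup, while the infinite cyclic group `⟨σ⟩`
maps non-trivially to `M`. -/

/-! ### Differentials and transcendence bases -/

/-- An extension is algebraic over the polynomial ring in a transcendence basis. -/
theorem IsTranscendenceBasis.isAlgebraic_mvPolynomial {R F ι : Type*} [CommRing R] [Nontrivial R]
    [CommRing F] [Algebra R F] {x : ι → F} (hx : IsTranscendenceBasis R x) :
    letI := (MvPolynomial.aeval (R := R) x).toAlgebra
    Algebra.IsAlgebraic (MvPolynomial ι R) F := by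
  let := (MvPolynomial.aeval (R := R) x).toAlgebra
  have := hx.isAlgebraic
  exact Algebra.IsAlgebraic.of_ringHom_of_comp_eq (R := MvPolynomial ι R)
    (S := Algebra.adjoin R (Set.range x)) (A := F) (B := F)
    hx.1.aevalEquiv (RingHom.id F) hx.1.aevalEquiv.surjective
    Function.injective_id (RingHom.ext fun z => hx.1.algebraMap_aevalEquiv z)

/-- In characteristic zero, the differentials of a transcendence basis form a basis of `Ω`. -/
theorem IsTranscendenceBasis.exists_basis_differentials {K F ι : Type*} [Field K] [Field F]
    [Algebra K F] [CharZero K] {x : ι → F} (hx : IsTranscendenceBasis K x) :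
    ∃ b : Module.Basis ι F (Ω[F⁄K]), ∀ i, b i = KaehlerDifferential.D K F (x i) := by
  let A := MvPolynomial ι K
  let : Algebra A F := (MvPolynomial.aeval x).toAlgebra
  have : IsScalarTower K A F := .of_algebraMap_eq fun r => (MvPolynomial.aeval_C x r).symm
  have hinj : Function.Injective (algebraMap A F) := hx.1
  have : FaithfulSMul A F := (faithfulSMul_iff_algebraMap_injective A F).2 hinj
  let : Algebra (FractionRing A) F := FractionRing.liftAlgebra A F
  have : IsScalarTower A (FractionRing A) F := FractionRing.isScalarTower_liftAlgebra A F
  have : CharZero A := charZero_of_injective_algebraMap (algebraMap K A).injective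
  have : CharZero (FractionRing A) :=
    charZero_of_injective_algebraMap (IsFractionRing.injective A (FractionRing A))
  have : Algebra.IsAlgebraic A F := hx.isAlgebraic_mvPolynomial
  have : Algebra.IsAlgebraic (FractionRing A) F :=
    Algebra.IsAlgebraic.extendScalars (IsFractionRing.injective A (FractionRing A))
  -- Characteristic zero enters here: algebraic extensions are separable, so `F` is formally étale
  -- over the polynomial ring and its differentials are obtained by base change.
  have : Algebra.FormallyEtale (FractionRing A) F := .of_isSeparable _ _
  have : Algebra.FormallyEtale A (FractionRing A) := .of_isLocalization (nonZeroDivisors A)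
  have : Algebra.FormallyEtale A F := .comp A (FractionRing A) F
  refine ⟨((KaehlerDifferential.mvPolynomialBasis K ι).baseChange F).map
    (KaehlerDifferential.tensorKaehlerEquivOfFormallyEtale K A F), fun i => ?_⟩
  rw [Module.Basis.map_apply, Module.Basis.baseChange_apply,
    KaehlerDifferential.mvPolynomialBasis_apply,
    ← KaehlerDifferential.tensorKaehlerEquivOfFormallyEtale_symm_D_algebraMap,
    LinearEquiv.apply_symm_apply]
  congr 1
  exact MvPolynomial.aeval_X x i

/-- In characteristic zero, the differentials of algebraically independent elements are linearly
independent. -/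
theorem AlgebraicIndependent.linearIndependent_differentials {K F : Type*} [Field K] [Field F]
    [Algebra K F] [CharZero K] {s : Set F} (hs : AlgebraicIndepOn K id s) :
    LinearIndependent F fun i : s => KaehlerDifferential.D K F i := by
  obtain ⟨t, hst, ht⟩ := exists_isTranscendenceBasis_superset hs
  obtain ⟨b, hb⟩ := ht.exists_basis_differentials
  convert! b.linearIndependent.comp (Set.inclusion hst) (Set.inclusion_injective hst) using 1
  ext i
  simp [hb]

/-- In characteristic zero, the elements with zero differential are the algebraic ones. -/
theorem KaehlerDifferential.isAlgebraic_of_D_eq_zero {K F : Type*} [Field K] [Field F]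
    [Algebra K F] [CharZero K] {x : F} (hx : KaehlerDifferential.D K F x = 0) :
    IsAlgebraic K x := by
  by_contra h
  have : AlgebraicIndepOn K id ({x} : Set F) :=
    algebraicIndependent_unique_type_iff.2 h
  have hli := this.linearIndependent_differentials
  exact hli.ne_zero (⟨x, Set.mem_singleton x⟩ : ({x} : Set F)) hx

/-- Algebraically closed extensions of a ring with transcendence bases indexed by the same set are
isomorphic, by an isomorphism matching the bases. -/
theorem IsAlgClosed.exists_algEquiv_of_isTranscendenceBasis {R K L ι : Type*} [CommRing R]
    [IsDomain R] [Field K] [Field L] [Algebra R K] [Algebra R L] [IsAlgClosed K] [IsAlgClosed L]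
    {x : ι → K} {y : ι → L} (hx : IsTranscendenceBasis R x) (hy : IsTranscendenceBasis R y) :
    ∃ e : K ≃ₐ[R] L, ∀ i, e (x i) = y i := by
  let A := MvPolynomial ι R
  let : Algebra A K := (MvPolynomial.aeval x).toAlgebra
  let : Algebra A L := (MvPolynomial.aeval y).toAlgebra
  have : IsScalarTower R A K := .of_algebraMap_eq fun r => (MvPolynomial.aeval_C x r).symm
  have : IsScalarTower R A L := .of_algebraMap_eq fun r => (MvPolynomial.aeval_C y r).symm
  have : FaithfulSMul A K := (faithfulSMul_iff_algebraMap_injective A K).2 hx.1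
  have : FaithfulSMul A L := (faithfulSMul_iff_algebraMap_injective A L).2 hy.1
  have : IsAlgClosure A K := ⟨inferInstance, hx.isAlgebraic_mvPolynomial⟩
  have : IsAlgClosure A L := ⟨inferInstance, hy.isAlgebraic_mvPolynomial⟩
  refine ⟨(IsAlgClosure.equiv A K L).restrictScalars R, fun i => ?_⟩
  have h := (IsAlgClosure.equiv A K L).commutes (MvPolynomial.X i)
  have hK : algebraMap A K (MvPolynomial.X i) = x i := MvPolynomial.aeval_X x i
  have hL : algebraMap A L (MvPolynomial.X i) = y i := MvPolynomial.aeval_X y i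
  rwa [hK, hL] at h

/-! ### Independent differentials and linear disjointness -/

namespace KaehlerDifferential

variable {k F : Type*} [Field k] [Field F] [Algebra k F]

/-- For a subspace `M` of `Ω` over an intermediate field `K`, the elements of `K` whose differential
lies in `M` form a field. -/
def fieldOfD (K : IntermediateField k F) (M : Submodule K (Ω[F⁄k])) : IntermediateField k F where
  carrier := {x | x ∈ K ∧ D k F x ∈ M}
  mul_mem' := by
    rintro x y ⟨hx, hdx⟩ ⟨hy, hdy⟩
    refine ⟨mul_mem hx hy, ?_⟩
    rw [Derivation.leibniz]
    exact add_mem (M.smul_mem ⟨x, hx⟩ hdy) (M.smul_mem ⟨y, hy⟩ hdx)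
  add_mem' := by
    rintro x y ⟨hx, hdx⟩ ⟨hy, hdy⟩
    exact ⟨add_mem hx hy, by rw [map_add]; exact add_mem hdx hdy⟩
  algebraMap_mem' c := ⟨K.algebraMap_mem c, by rw [Derivation.map_algebraMap]; exact M.zero_mem⟩
  inv_mem' := by
    rintro x ⟨hx, hdx⟩
    refine ⟨inv_mem hx, ?_⟩
    rw [Derivation.leibniz_inv]
    exact M.smul_mem (⟨-x⁻¹ ^ 2, neg_mem (pow_mem (inv_mem hx) 2)⟩ : K) hdx

/-- Differentiating `p(x)` gives `p'(x) dx` modulo `M` when the coefficients of `p` have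
differentials in `M`. For the minimal polynomial the left side is zero, and `p'(x)` is an invertible
element of `K` by separability. -/
theorem D_mem_of_isAlgebraic_fieldOfD [CharZero k] {K : IntermediateField k F}
    {M : Submodule K (Ω[F⁄k])} {x : F} (hx : x ∈ K) (h : IsAlgebraic (fieldOfD K M) x) :
    D k F x ∈ M := by
  have key (p : Polynomial (fieldOfD K M)) :
      Polynomial.aeval x p ∈ K ∧
        D k F (Polynomial.aeval x p) - Polynomial.aeval x p.derivative • D k F x ∈ M := by
    induction p using Polynomial.induction_on' with
    | add p q hp hq =>
      refine ⟨by rw [map_add]; exact add_mem hp.1 hq.1, ?_⟩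
      convert! add_mem hp.2 hq.2 using 1
      simp only [map_add, add_smul]
      abel
    | monomial n a =>
      have hxn := pow_mem hx n
      refine ⟨?_, ?_⟩
      · rw [Polynomial.aeval_monomial]
        exact mul_mem a.2.1 hxn
      · convert! M.smul_mem (⟨x ^ n, hxn⟩ : K) a.2.2 using 1
        have hpow : D k F (x ^ n) = ((n : F) * x ^ (n - 1)) • D k F x := by
          rw [Derivation.leibniz_pow, mul_smul, Nat.cast_smul_eq_nsmul]
        rw [Polynomial.aeval_monomial, Derivation.leibniz, Polynomial.derivative_monomial,
          Polynomial.aeval_monomial, hpow, map_mul, map_natCast, smul_smul, mul_assoc,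
          add_sub_cancel_left]
        rfl
  have : CharZero (fieldOfD K M) := charZero_of_injective_algebraMap (algebraMap k _).injective
  have hmin := (key (minpoly _ x)).2
  rw [minpoly.aeval, map_zero, zero_sub, Submodule.neg_mem_iff] at hmin
  have hne := (minpoly.irreducible h.isIntegral).separable.aeval_derivative_ne_zero
    (minpoly.aeval _ x)
  have hK : Polynomial.aeval x (minpoly (fieldOfD K M) x).derivative ∈ K := (key _).1
  convert! M.smul_mem (⟨_, inv_mem hK⟩ : K) hmin using 1
  exact (inv_smul_smul₀ hne _).symm

/-- In characteristic zero, differentials of elements algebraic over `k[S]` are combinations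
of the differentials of the elements of `S`. -/
theorem D_mem_of_isAlgebraic_adjoin [CharZero k] {K : IntermediateField k F}
    {M : Submodule K (Ω[F⁄k])} {S : Set F} (hSK : ∀ s ∈ S, s ∈ K) (hS : ∀ s ∈ S, D k F s ∈ M)
    {x : F} (hx : x ∈ K) (h : IsAlgebraic (Algebra.adjoin k S) x) : D k F x ∈ M :=
  D_mem_of_isAlgebraic_fieldOfD hx <| h.tower_top_of_subalgebra_le
    (B := (fieldOfD K M).toSubalgebra) <| Algebra.adjoin_le fun s hs => ⟨hSK s hs, hS s hs⟩

variable (k) in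
/-- The span over `F` of the differentials of the elements of `S`. -/
noncomputable def diffSpan (S : Set F) : Submodule F (Ω[F⁄k]) := Submodule.span F (D k F '' S)

theorem D_mem_diffSpan {S : Set F} {x : F} (hx : x ∈ S) : D k F x ∈ diffSpan k S :=
  Submodule.subset_span ⟨x, hx, rfl⟩

theorem diffSpan_mono {S T : Set F} (h : S ⊆ T) : diffSpan k S ≤ diffSpan k T :=
  Submodule.span_mono (Set.image_mono h)

theorem D_mem_diffSpan_of_mem_adjoin {S : Set F} {x : F} (hx : x ∈ IntermediateField.adjoin k S) :
    D k F x ∈ diffSpan k S := by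
  -- Taking `⊤` as the intermediate field turns an `F`-subspace into an input for `fieldOfD`.
  let M : Submodule (⊤ : IntermediateField k F) (Ω[F⁄k]) :=
    (diffSpan k S).restrictScalars (⊤ : IntermediateField k F)
  have hle : IntermediateField.adjoin k S ≤ fieldOfD ⊤ M := by
    refine IntermediateField.adjoin_le_iff.2 fun s hs => ?_
    refine And.intro IntermediateField.mem_top ?_
    change D k F s ∈ diffSpan k S
    exact D_mem_diffSpan hs
  exact (hle hx).2

theorem finiteDimensional_diffSpan {S : Set F} (hS : S.Finite) :
    FiniteDimensional F (diffSpan k S) :=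
  FiniteDimensional.span_of_finite F (hS.image _)

/-- If the differentials of `K` and of a family `e` are independent, and elements of `K` with zero
differential are constants, then linear independence of `e` over `k` persists over `K`. -/
theorem linearIndependent_of_disjoint {K : IntermediateField k F} {ι κ : Type*} {s : κ → F}
    (hs : LinearIndependent F fun j => D k F (s j))
    (hK : ∀ l ∈ K, D k F l ∈ Submodule.span K (Set.range fun j => D k F (s j)))
    (hk : ∀ l ∈ K, D k F l = 0 → l ∈ (⊥ : IntermediateField k F))
    {N : Submodule F (Ω[F⁄k])}
    (hN : Disjoint N (Submodule.span F (Set.range fun j => D k F (s j))))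
    {e : ι → F} (heN : ∀ i, D k F (e i) ∈ N) (he : LinearIndependent k e) :
    LinearIndependent K e := by
  classical
  have hsK : LinearIndependent K fun j => D k F (s j) := hs.restrict_scalars' K
  let coord (j : κ) : K → K := fun l => hsK.repr ⟨_, hK l l.2⟩ j
  have hcoord (l : K) (hl : D k F (l : F) = 0) (j : κ) : coord j l = 0 := by
    have h0 : (⟨_, hK l l.2⟩ : Submodule.span K (Set.range fun j => D k F (s j))) = 0 :=
      Subtype.ext hl
    change hsK.repr ⟨_, hK l l.2⟩ j = 0
    rw [h0, map_zero, Finsupp.zero_apply]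
  have hsum (l : K) : Finsupp.linearCombination F (fun j => D k F (s j))
      ((hsK.repr ⟨_, hK l l.2⟩).mapRange Subtype.val rfl) = D k F (l : F) := by
    have := hsK.linearCombination_repr ⟨_, hK l l.2⟩
    rw [Finsupp.linearCombination_apply] at this ⊢
    rw [Finsupp.sum_mapRange_index (by simp)]
    exact this
  rw [linearIndependent_iff]
  -- Induction on the length of a relation: normalize one coefficient to `1` and differentiate.
  -- Disjointness separates the terms containing `d(e i)` from those containing the differentials of
  -- the coefficients.
  suffices ∀ (n : ℕ) (l : ι →₀ K), l.support.card ≤ n → Finsupp.linearCombination K e l = 0 →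
      l = 0 from fun l => this _ l le_rfl
  intro n
  induction n with
  | zero => exact fun l hl _ => Finsupp.support_eq_empty.1 (Finset.card_eq_zero.1 (by omega))
  | succ n ih =>
    intro l hl hl0
    by_contra hne
    obtain ⟨i₀, hi₀⟩ := Finsupp.support_nonempty_iff.2 hne
    have hi₀' := Finsupp.mem_support_iff.1 hi₀
    obtain ⟨m, hm⟩ : ∃ m : ι →₀ K, m = (l i₀)⁻¹ • l := ⟨_, rfl⟩
    have hm0 : Finsupp.linearCombination K e m = 0 := by rw [hm, map_smul, hl0, smul_zero]
    have hm1 : m i₀ = 1 := by simp [hm, hi₀']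
    have hms : m.support ⊆ l.support := hm ▸ Finsupp.support_smul
    have hD : ∑ i ∈ m.support, e i • D k F (m i : F) = 0 := by
      have h1 : ∑ i ∈ m.support, ((m i : F) • D k F (e i) + e i • D k F (m i : F)) = 0 := by
        rw [Finsupp.linearCombination_apply, Finsupp.sum] at hm0
        have := congrArg (D k F) hm0
        rw [map_zero, map_sum] at this
        rw [← this]
        exact Finset.sum_congr rfl fun i _ => ((D k F).leibniz (m i : F) (e i)).symm
      rw [Finset.sum_add_distrib, add_eq_zero_iff_eq_neg'] at h1
      refine Submodule.disjoint_def.1 hN _ (h1 ▸ neg_mem (sum_mem fun i _ =>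
        N.smul_mem _ (heN i))) (sum_mem fun i _ => Submodule.smul_mem _ _ ?_)
      exact Submodule.span_le_restrictScalars K F _ (hK _ (m i).2)
    -- The `j`-th coordinates of the differentials of the coefficients again form a relation,
    -- shorter because `d1 = 0` removes the index `i₀`. Once they all vanish, the coefficients are
    -- constants.
    have hzero (j : κ) : m.mapRange (coord j) (hcoord 0 (map_zero _) j) = 0 := by
      refine ih _ ?_ ?_
      · have hlt : (m.mapRange (coord j) (hcoord 0 (map_zero _) j)).support ⊆ l.support.erase i₀ := by
          intro i hi
          rw [Finsupp.mem_support_iff, Finsupp.mapRange_apply] at hi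
          refine Finset.mem_erase.2 ⟨?_, hms (Finsupp.mem_support_iff.2 fun h => hi ?_)⟩
          · rintro rfl
            exact hi (hcoord _ (by rw [hm1]; exact Derivation.map_one_eq_zero _) j)
          · rw [h]
            exact hcoord 0 (map_zero _) j
        have := Finset.card_le_card hlt
        rw [Finset.card_erase_of_mem hi₀] at this
        omega
      · have h2 : Finsupp.linearCombination F (fun j => D k F (s j))
            (∑ i ∈ m.support, e i •
              (hsK.repr ⟨_, hK (m i) (m i).2⟩).mapRange Subtype.val rfl) = 0 := by
          rw [map_sum, ← hD]
          exact Finset.sum_congr rfl fun i _ => by rw [map_smul, hsum]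
        have h3 := DFunLike.congr_fun (linearIndependent_iff.1 hs _ h2) j
        rw [Finsupp.finsetSum_apply, Finsupp.zero_apply] at h3
        rw [Finsupp.linearCombination_apply, Finsupp.sum_mapRange_index (by simp), Finsupp.sum,
          ← h3]
        exact Finset.sum_congr rfl fun i _ => mul_comm _ _
    have hconst (i : ι) : ∃ c : k, algebraMap k F c = m i := by
      refine IntermediateField.mem_bot.1 (hk _ (m i).2 ?_)
      rw [← hsum]
      have : hsK.repr ⟨_, hK (m i) (m i).2⟩ = 0 :=
        Finsupp.ext fun j => DFunLike.congr_fun (hzero j) i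
      rw [this, Finsupp.mapRange_zero, map_zero]
    choose c hc using hconst
    have := linearIndependent_iff'.1 he m.support c (by
      rw [Finsupp.linearCombination_apply, Finsupp.sum] at hm0
      rw [← hm0]
      exact Finset.sum_congr rfl fun i _ => by rw [Algebra.smul_def, hc]; rfl) i₀
      (Finsupp.mem_support_iff.2 (by rw [hm1]; exact one_ne_zero))
    have h1 := hc i₀
    rw [this, map_zero, hm1] at h1
    exact zero_ne_one h1

/-- Over an algebraically closed field of characteristic zero, algebras with independent
differentials are linearly disjoint. -/
theorem linearDisjoint_adjoin [CharZero k] [IsAlgClosed k] {S T : Set F}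
    (h : Disjoint (diffSpan k S) (diffSpan k T)) :
    (Algebra.adjoin k S).LinearDisjoint (Algebra.adjoin k T) := by
  -- A maximal independent part of `S` gives coordinates in `k(S)` for the differentials of `k(S)`.
  -- A `k`-basis of `k[T]` then stays independent over `k(S)`, hence over `k[S]`.
  obtain ⟨s, hs⟩ := (AlgebraicIndependent.matroid k F).exists_isBasis S
  obtain ⟨hind, hsS, halg⟩ := AlgebraicIndependent.matroid_isBasis_iff.1 hs
  let K := IntermediateField.adjoin k S
  have hle : Algebra.adjoin k S ≤ K.toSubalgebra := IntermediateField.algebra_adjoin_le_adjoin k S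
  let b := Module.Basis.ofVectorSpace k (Algebra.adjoin k T)
  let M : Submodule K (Ω[F⁄k]) := Submodule.span K (Set.range fun j : s => D k F j)
  have hM : K ≤ fieldOfD K M := by
    refine IntermediateField.adjoin_le_iff.2 fun x hx => ?_
    have hxK : x ∈ K := IntermediateField.subset_adjoin k S hx
    exact ⟨hxK, D_mem_of_isAlgebraic_adjoin
      (fun y hy => IntermediateField.subset_adjoin k S (hsS hy))
      (fun y hy => Submodule.subset_span (Set.mem_range_self (⟨y, hy⟩ : s))) hxK (halg x hx)⟩
  have hli : LinearIndependent K fun i => ((b i : Algebra.adjoin k T) : F) := by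
    refine linearIndependent_of_disjoint (N := diffSpan k T)
      hind.linearIndependent_differentials (fun l hl => (hM hl).2)
      (fun l _ hl => ?_) ?_ (fun i => ?_) ?_
    · have := IntermediateField.isAlgebraic_adjoin_simple (isAlgebraic_of_D_eq_zero hl).isIntegral
      rw [← IntermediateField.eq_bot_of_isAlgClosed_of_isAlgebraic (IntermediateField.adjoin k {l})]
      exact IntermediateField.mem_adjoin_simple_self k l
    · refine h.symm.mono_right (Submodule.span_le.2 ?_)
      rintro _ ⟨j, rfl⟩
      exact D_mem_diffSpan (hsS j.2)
    · exact D_mem_diffSpan_of_mem_adjoin (IntermediateField.algebra_adjoin_le_adjoin k T (b i).2)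
    · exact b.linearIndependent.map' (Algebra.adjoin k T).val.toLinearMap
        (LinearMap.ker_eq_bot.2 Subtype.val_injective)
  refine Subalgebra.LinearDisjoint.of_basis_right _ _ b ?_
  rw [linearIndependent_iff'] at hli ⊢
  intro I g hg i hi
  have := hli I (fun i => ⟨g i, hle (g i).2⟩) hg i hi
  exact Subtype.ext (congrArg (Subtype.val : K → F) this)

end KaehlerDifferential

/-! ### Subspaces under semilinear bijections -/

open scoped Pointwise
open KaehlerDifferential

/-- Subspaces matched by a semilinear bijection have the same dimension. -/
theorem finrank_eq_of_semilinear {F M : Type*} [Field F] [AddCommGroup M] [Module F M]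
    (σ : F ≃+* F) (τ : M ≃+ M) (h : ∀ (f : F) (m : M), τ (f • m) = σ f • τ m)
    {V V' : Submodule F M} (hV : ∀ m, τ m ∈ V' ↔ m ∈ V) :
    Module.finrank F V = Module.finrank F V' := by
  let j : V ≃+ V' :=
    { toFun := fun v => ⟨τ v, (hV v).2 v.2⟩
      invFun := fun v => ⟨τ.symm v, (hV _).1 (by rw [τ.apply_symm_apply]; exact v.2)⟩
      left_inv := fun v => Subtype.ext (τ.symm_apply_apply _)
      right_inv := fun v => Subtype.ext (τ.apply_symm_apply _)
      map_add' := fun v w => Subtype.ext (map_add τ _ _) }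
  exact congrArg Cardinal.toNat
    (rank_eq_of_equiv_equiv σ j σ.bijective fun r m => Subtype.ext (h r m))

/-- A finite-dimensional subspace mapped into itself by a semilinear bijection is mapped onto
itself. -/
theorem mem_iff_of_semilinear {F M : Type*} [Field F] [AddCommGroup M] [Module F M]
    (σ : F ≃+* F) (τ : M ≃+ M) (h : ∀ (f : F) (m : M), τ (f • m) = σ f • τ m)
    {V : Submodule F M} [FiniteDimensional F V] (hV : ∀ m ∈ V, τ m ∈ V) (m : M) :
    τ m ∈ V ↔ m ∈ V := by
  refine ⟨fun hm => ?_, hV m⟩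
  -- This is the image of `V` under `τ`: it is contained in `V` and has the same dimension.
  let V' : Submodule F M :=
    { carrier := {m | τ.symm m ∈ V}
      add_mem' := fun {a b} ha hb => by
        change τ.symm (a + b) ∈ V
        rw [map_add]
        exact add_mem ha hb
      zero_mem' := by
        change τ.symm 0 ∈ V
        rw [map_zero]
        exact V.zero_mem
      smul_mem' := fun c a ha => by
        have : τ.symm (c • a) = σ.symm c • τ.symm a := by
          rw [AddEquiv.symm_apply_eq, h, σ.apply_symm_apply, τ.apply_symm_apply]
        change τ.symm (c • a) ∈ V
        rw [this]
        exact V.smul_mem _ ha }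
  have hmem (a : M) : a ∈ V' ↔ τ.symm a ∈ V := Iff.rfl
  have hle : V' ≤ V := fun a ha => by simpa using hV _ ((hmem a).1 ha)
  have heq : V' = V := Submodule.eq_of_le_of_finrank_eq hle
    (finrank_eq_of_semilinear σ τ h fun m => by rw [hmem, τ.symm_apply_apply]).symm
  rw [← heq, hmem, τ.symm_apply_apply] at hm
  exact hm

/-! ### The group action on differentials -/

namespace FieldAut

section Action

variable {k F : Type*} [Field k] [Field F] [Algebra k F]

/-- An automorphism over `k`, as an element of the topological group `FieldAut k F`. -/
def ofAlgEquiv (e : F ≃ₐ[k] F) : FieldAut k F := e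

theorem ofAlgEquiv_smul (e : F ≃ₐ[k] F) (x : F) : ofAlgEquiv e • x = e x := rfl

theorem smul_algebraMap' (g : FieldAut k F) (c : k) : g • algebraMap k F c = algebraMap k F c :=
  AlgEquiv.commutes (show F ≃ₐ[k] F from g) c

theorem differentials_induction {p : Ω[F⁄k] → Prop} (ω : Ω[F⁄k]) (hD : ∀ x, p (D k F x))
    (hadd : ∀ a b, p a → p b → p (a + b)) (hsmul : ∀ (f : F) a, p a → p (f • a)) : p ω := by
  have hω : ω ∈ Submodule.span F (Set.range (D k F)) := by
    rw [span_range_derivation]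
    trivial
  refine Submodule.span_induction (p := fun ω _ => p ω) ?_ ?_ (fun _ _ _ _ => hadd _ _)
    (fun f a _ => hsmul f a) hω
  · rintro _ ⟨x, rfl⟩
    exact hD x
  · rw [← zero_smul F (D k F 0)]
    exact hsmul _ _ (hD 0)

theorem actOnDifferentials_mul (g h : FieldAut k F) (ω : Ω[F⁄k]) :
    actOnDifferentials (g * h) ω = actOnDifferentials g (actOnDifferentials h ω) := by
  induction ω using differentials_induction with
  | hD x => rw [actOnDifferentials_D, actOnDifferentials_D, actOnDifferentials_D, mul_smul]
  | hadd a b ha hb => rw [map_add, map_add, map_add, ha, hb]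
  | hsmul f a ha => rw [actOnDifferentials_smul, actOnDifferentials_smul, actOnDifferentials_smul, ha,
      mul_smul]

theorem actOnDifferentials_one (ω : Ω[F⁄k]) : actOnDifferentials (1 : FieldAut k F) ω = ω := by
  induction ω using differentials_induction with
  | hD x => rw [actOnDifferentials_D, one_smul]
  | hadd a b ha hb => rw [map_add, ha, hb]
  | hsmul f a ha => rw [actOnDifferentials_smul, ha, one_smul]

/-- The action of an automorphism on `Ω`, as an additive bijection. -/
noncomputable def differentialsEquiv (g : FieldAut k F) : Ω[F⁄k] ≃+ Ω[F⁄k] where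
  __ := actOnDifferentials g
  invFun := actOnDifferentials g⁻¹
  left_inv ω := by
    change actOnDifferentials g⁻¹ (actOnDifferentials g ω) = ω
    rw [← actOnDifferentials_mul, inv_mul_cancel, actOnDifferentials_one]
  right_inv ω := by
    change actOnDifferentials g (actOnDifferentials g⁻¹ ω) = ω
    rw [← actOnDifferentials_mul, mul_inv_cancel, actOnDifferentials_one]

theorem actOnDifferentials_injective (g : FieldAut k F) :
    Function.Injective (actOnDifferentials g) :=
  (differentialsEquiv g).injective

theorem actOnDifferentials_mem_diffSpan {g : FieldAut k F} {S : Set F} {ω : Ω[F⁄k]}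
    (hω : ω ∈ diffSpan k S) : actOnDifferentials g ω ∈ diffSpan k (g • S) := by
  refine Submodule.span_induction (p := fun ω _ => actOnDifferentials g ω ∈ diffSpan k (g • S))
    ?_ ?_ (fun a b _ _ ha hb => ?_) (fun f a _ ha => ?_) hω
  · rintro _ ⟨s, hs, rfl⟩
    rw [actOnDifferentials_D]
    exact D_mem_diffSpan (Set.smul_mem_smul_set hs)
  · rw [map_zero]
    exact Submodule.zero_mem _
  · rw [map_add]
    exact add_mem ha hb
  · rw [actOnDifferentials_smul]
    exact Submodule.smul_mem _ _ ha

theorem actOnDifferentials_mem_diffSpan_iff {g : FieldAut k F} {S : Set F} {ω : Ω[F⁄k]} :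
    actOnDifferentials g ω ∈ diffSpan k (g • S) ↔ ω ∈ diffSpan k S := by
  refine ⟨fun h => ?_, actOnDifferentials_mem_diffSpan⟩
  have := actOnDifferentials_mem_diffSpan (g := g⁻¹) h
  rwa [← actOnDifferentials_mul, inv_mul_cancel, actOnDifferentials_one, inv_smul_smul] at this

theorem disjoint_diffSpan_smul_iff {g : FieldAut k F} {S T : Set F} :
    Disjoint (diffSpan k (g • S)) (diffSpan k (g • T)) ↔
      Disjoint (diffSpan k S) (diffSpan k T) := by
  have key (h : FieldAut k F) (S T : Set F) (hd : Disjoint (diffSpan k (h • S))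
      (diffSpan k (h • T))) : Disjoint (diffSpan k S) (diffSpan k T) := by
    refine Submodule.disjoint_def.2 fun ω hS hT => actOnDifferentials_injective h ?_
    rw [map_zero]
    exact Submodule.disjoint_def.1 hd _ (actOnDifferentials_mem_diffSpan hS)
      (actOnDifferentials_mem_diffSpan hT)
  refine ⟨key g S T, fun h => key g⁻¹ _ _ ?_⟩
  rwa [inv_smul_smul, inv_smul_smul]

end Action

/-! ### Homogeneity and gluing of automorphisms -/

section Homogeneity

/-- An algebraically closed field has transcendence bases indexed by the integers over subrings of
finite transcendence degree, if its transcendence degree is countably infinite. -/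
theorem _root_.Algebra.exists_isTranscendenceBasis_int {k D F : Type*} [Field k] [CommRing D]
    [Field F] [Algebra k D] [Algebra k F] [Algebra D F] [IsScalarTower k D F] [FaithfulSMul D F]
    (hF : Algebra.trdeg k F = Cardinal.aleph0) (hD : Algebra.trdeg k D < Cardinal.aleph0) :
    ∃ x : ℤ → F, IsTranscendenceBasis D x := by
  have : IsDomain D := (FaithfulSMul.algebraMap_injective D F).isDomain (algebraMap D F)
  have : FaithfulSMul k D := (faithfulSMul_iff_algebraMap_injective k D).2
    (algebraMap k D).injective
  obtain ⟨s, hs⟩ := exists_isTranscendenceBasis D F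
  have hadd := lift_trdeg_add_eq k D F
  rw [hF, Cardinal.lift_aleph0] at hadd
  have hs' := hs.cardinalMk_eq_trdeg
  have hcard : Cardinal.mk s = Cardinal.aleph0 := by
    rw [hs']
    refine le_antisymm ?_ ?_
    · rw [← Cardinal.lift_le_aleph0, ← hadd]
      exact le_add_self
    · by_contra hlt
      have h1 := Cardinal.lift_lt_aleph0.2 hD
      have h2 := Cardinal.lift_lt_aleph0.2 (not_le.1 hlt)
      exact (Cardinal.add_lt_aleph0 h1 h2).ne hadd
  obtain ⟨e⟩ : Nonempty (ℤ ≃ s) := by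
    have := Cardinal.mk_eq_aleph0 ℤ
    refine Cardinal.lift_mk_eq'.1 ?_
    rw [this, hcard, Cardinal.lift_aleph0, Cardinal.lift_aleph0]
  exact ⟨_, hs.comp_equiv e⟩

variable {k F : Type*} [Field k] [Field F] [Algebra k F]

/-- Homogeneity: two embeddings of an algebra of finite transcendence degree into an algebraically
closed field of countably infinite transcendence degree are conjugate. -/
theorem exists_smul_comp_eq [IsAlgClosed F] (hF : Algebra.trdeg k F = Cardinal.aleph0)
    {A : Type*} [CommRing A] [Algebra k A] (hA : Algebra.trdeg k A < Cardinal.aleph0)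
    (φ ψ : A →ₐ[k] F) (hφ : Function.Injective φ) (hψ : Function.Injective ψ) :
    ∃ g : FieldAut k F, ∀ a, g • φ a = ψ a := by
  have : IsDomain A := hφ.isDomain φ.toRingHom
  -- Each embedding makes `F` an algebraically closed `A`-algebra with a transcendence basis indexed
  -- by `ℤ`. An `A`-isomorphism between the two structures is the conjugating automorphism.
  have basis (χ : A →ₐ[k] F) (hχ : Function.Injective χ) :
      letI := χ.toAlgebra
      ∃ x : ℤ → F, IsTranscendenceBasis A x := by
    let := χ.toAlgebra
    have : IsScalarTower k A F := .of_algebraMap_eq fun r => (χ.commutes r).symm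
    have : FaithfulSMul A F := (faithfulSMul_iff_algebraMap_injective A F).2 hχ
    exact Algebra.exists_isTranscendenceBasis_int hF hA
  obtain ⟨x, hx⟩ := basis φ hφ
  obtain ⟨y, hy⟩ := basis ψ hψ
  obtain ⟨e, -⟩ := @IsAlgClosed.exists_algEquiv_of_isTranscendenceBasis A F F ℤ _ _ _ _
    φ.toAlgebra ψ.toAlgebra _ _ x y hx hy
  have he (a : A) : e (φ a) = ψ a :=
    @AlgEquiv.commutes A F F _ _ _ φ.toAlgebra ψ.toAlgebra e a
  refine ⟨ofAlgEquiv (AlgEquiv.ofRingEquiv (f := @AlgEquiv.toRingEquiv A F F _ _ _ φ.toAlgebra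
    ψ.toAlgebra e) fun r => ?_), fun a => he a⟩
  have := he (algebraMap k A r)
  rwa [φ.commutes, ψ.commutes] at this

/-- An automorphism can be changed into one fixing a finite set `S` pointwise, without changing its
values on a finite set `T`, if `T` and its image are independent of `S`. -/
theorem exists_fixing_of_disjoint [CharZero k] [IsAlgClosed k] [IsAlgClosed F]
    (hF : Algebra.trdeg k F = Cardinal.aleph0) {S T : Set F} (hS : S.Finite) (hT : T.Finite)
    (g : FieldAut k F) (h₁ : Disjoint (diffSpan k S) (diffSpan k T))
    (h₂ : Disjoint (diffSpan k S) (diffSpan k (g • T))) :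
    ∃ h : FieldAut k F, (∀ s ∈ S, h • s = s) ∧ ∀ t ∈ T, h • t = g • t := by
  let A := Algebra.adjoin k S
  let B := Algebra.adjoin k T
  let ge : F ≃ₐ[k] F := g
  have hmap : B.map (ge : F →ₐ[k] F) = Algebra.adjoin k (g • T) := AlgHom.map_adjoin _ _
  have hφ := (linearDisjoint_adjoin h₁).injective
  have hψ : Function.Injective (A.mulMap (B.map (ge : F →ₐ[k] F))) := by
    rw [hmap]
    exact (linearDisjoint_adjoin h₂).injective
  let e : B ≃ₐ[k] B.map (ge : F →ₐ[k] F) := B.equivMapOfInjective _ ge.injective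
  -- The two embeddings of `A ⊗ B` to be conjugated are `a ⊗ b ↦ a b` and `a ⊗ b ↦ a g(b)`; linear
  -- disjointness makes both injective.
  let φ := A.mulMap B
  let ψ := (A.mulMap (B.map (ge : F →ₐ[k] F))).comp
    (Algebra.TensorProduct.congr AlgEquiv.refl e : TensorProduct k A B ≃ₐ[k] _).toAlgHom
  have : Algebra.FiniteType k A := Subalgebra.fg_iff_finiteType _ |>.1 ⟨hS.toFinset, by simp [A]⟩
  have : Algebra.FiniteType k B := Subalgebra.fg_iff_finiteType _ |>.1 ⟨hT.toFinset, by simp [B]⟩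
  have : Algebra.FiniteType k (TensorProduct k A B) := .trans (S := A) ‹_› inferInstance
  have : IsDomain (TensorProduct k A B) := hφ.isDomain φ.toRingHom
  obtain ⟨h, hh⟩ := exists_smul_comp_eq hF
    (trdeg_lt_aleph0_of_finiteType (R := k) (S := TensorProduct k A B)) φ ψ hφ
    (hψ.comp (AlgEquiv.injective _))
  refine ⟨h, fun s hs => ?_, fun t ht => ?_⟩
  · have := hh ((⟨s, Algebra.subset_adjoin hs⟩ : A) ⊗ₜ[k] (1 : B))
    simpa [φ, ψ] using this
  · have := hh ((1 : A) ⊗ₜ[k] (⟨t, Algebra.subset_adjoin ht⟩ : B))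
    have he : ((e ⟨t, Algebra.subset_adjoin ht⟩ : B.map (ge : F →ₐ[k] F)) : F) = g • t := rfl
    simpa [φ, ψ, he] using this

end Homogeneity

end FieldAut

/-! ### Shift automorphisms -/

namespace FieldAut

section Shift

variable {k F : Type*} [Field k] [Field F] [Algebra k F] [CharZero k] [IsAlgClosed F]

theorem exists_bound_of_fg {F M : Type*} [Field F] [AddCommGroup M] [Module F M]
    (b : Module.Basis ℤ F M) {V : Submodule F M} (hV : V.FG) :
    ∃ N : ℤ, ∀ m ∈ V, ∀ i, N < |i| → b.repr m i = 0 := by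
  classical
  obtain ⟨s, rfl⟩ := hV
  obtain ⟨N, hN⟩ := ((s.biUnion fun m => (b.repr m).support).image fun i => |i|).bddAbove
  refine ⟨N, fun m hm i hi => ?_⟩
  refine Submodule.span_induction (p := fun m _ => b.repr m i = 0) (fun m hm => ?_) (by simp)
    (fun x y _ _ hx hy => by simp [hx, hy]) (fun c x _ hx => by simp [hx]) hm
  by_contra h
  exact absurd (hN (Finset.mem_coe.2 (Finset.mem_image_of_mem _ (Finset.mem_biUnion.2
    ⟨m, hm, Finsupp.mem_support_iff.2 h⟩)))) (not_le.2 hi)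

/-- The shift of a transcendence basis indexed by the integers moves every finitely generated space
of differentials away from any other one. -/
theorem exists_shift {x : ℤ → F} (hx : IsTranscendenceBasis k x) :
    ∃ σ : FieldAut k F, ∀ V V' : Submodule F (Ω[F⁄k]), V.FG → V'.FG →
      ∃ n : ℕ, ∀ ω ∈ V, actOnDifferentials (σ ^ n) ω ∈ V' → ω = 0 := by
  obtain ⟨b, hb⟩ := hx.exists_basis_differentials
  obtain ⟨e, he⟩ := IsAlgClosed.exists_algEquiv_of_isTranscendenceBasis hx
    (hx.comp_equiv (Equiv.addRight 1))
  let σ := ofAlgEquiv e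
  have hσ (n : ℕ) (i : ℤ) : (σ ^ n) • x i = x (i + n) := by
    induction n with
    | zero => simp
    | succ n ih =>
      rw [pow_succ', mul_smul, ih]
      refine (he _).trans (congrArg x ?_)
      simp [add_assoc]
  have hrepr (n : ℕ) (ω : Ω[F⁄k]) (i : ℤ) :
      b.repr (actOnDifferentials (σ ^ n) ω) (i + n) = (σ ^ n) • b.repr ω i := by
    refine Submodule.span_induction (p := fun ω _ =>
      b.repr (actOnDifferentials (σ ^ n) ω) (i + n) = (σ ^ n) • b.repr ω i) ?_ (by simp)
      (fun a a' _ _ ha ha' => ?_) (fun f a _ ha => ?_) (b.mem_span ω)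
    · rintro _ ⟨j, rfl⟩
      rw [hb, actOnDifferentials_D, hσ, ← hb, ← hb, b.repr_self, b.repr_self]
      by_cases hij : j = i
      · subst hij
        simp
      · rw [Finsupp.single_eq_of_ne (by omega), Finsupp.single_eq_of_ne (by omega), smul_zero]
    · simp only [map_add, Finsupp.add_apply, ha, ha', smul_add]
    · simp only [actOnDifferentials_smul, map_smul, Finsupp.smul_apply, smul_eq_mul, ha, smul_mul']
  refine ⟨σ, fun V V' hV hV' => ?_⟩
  obtain ⟨N, hN⟩ := exists_bound_of_fg b hV
  obtain ⟨N', hN'⟩ := exists_bound_of_fg b hV'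
  -- Indices with `|i| ≤ N` are moved beyond `N'` by this shift; the `1` makes the inequality
  -- strict.
  refine ⟨(N.toNat + N'.toNat + 1), fun ω hω hω' => ?_⟩
  refine b.repr.injective (Finsupp.ext fun i => ?_)
  rw [map_zero, Finsupp.zero_apply]
  by_cases hi : N < |i|
  · exact hN ω hω i hi
  · have := hrepr (N.toNat + N'.toNat + 1) ω i
    rw [hN' _ hω' _ (by push_cast; grind)] at this
    exact (smul_eq_zero_iff_eq _).1 this.symm

end Shift

/-! ### Independence, generation by stabilizers and invariant differentials -/

section Independence

variable {k F : Type*} [Field k] [Field F] [Algebra k F] [CharZero k] [IsAlgClosed F]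

/-- A finite set can be made independent of another one over `S` by an automorphism fixing `S`. -/
theorem exists_fixing_inf_le (hF : Algebra.trdeg k F = Cardinal.aleph0) {S T B : Set F}
    (hS : S.Finite) (hT : T.Finite) (hB : B.Finite) :
    ∃ g : FieldAut k F, (∀ s ∈ S, g • s = s) ∧
      diffSpan k (g • T) ⊓ diffSpan k (S ∪ B) ≤ diffSpan k S := by
  -- Working over `k(S)` makes a shift fix `S`. The kernel of `Ω[F⁄k] → Ω[F⁄K]` lies in the span of
  -- `dS`, so it suffices to separate `T` from `B` after passing to `K`.
  let K := IntermediateField.adjoin k S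
  have hfg : K.FG := IntermediateField.fg_adjoin_of_finite hS
  have : Algebra.EssFiniteType k K := IntermediateField.essFiniteType_iff.2 hfg
  have : CharZero K := charZero_of_injective_algebraMap (algebraMap k K).injective
  obtain ⟨x, hx⟩ := Algebra.exists_isTranscendenceBasis_int (D := K) hF (trdeg_lt_aleph0 k K)
  obtain ⟨σ, hσ⟩ := exists_shift hx
  obtain ⟨n, hn⟩ := hσ (diffSpan K T) (diffSpan K B) (Submodule.fg_span (hT.image _))
    (Submodule.fg_span (hB.image _))
  let g : FieldAut k F := ofAlgEquiv (AlgEquiv.restrictScalars k (show F ≃ₐ[K] F from σ ^ n))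
  have hg (y : F) : g • y = (σ ^ n) • y := rfl
  have hgT : g • T = (σ ^ n) • T := rfl
  let π : Ω[F⁄k] →ₗ[F] Ω[F⁄K] := KaehlerDifferential.map k K F F
  have hπD (y : F) : π (D k F y) = D K F y := KaehlerDifferential.map_D k K F F y
  have hπ (R : Set F) : (diffSpan k R).map π = diffSpan K R := by
    rw [diffSpan, Submodule.map_span, ← Set.image_comp]
    exact congrArg (Submodule.span F) (Set.image_congr fun y _ => hπD y)
  have hker : LinearMap.ker π ≤ diffSpan k S := by
    intro ω hω
    obtain ⟨t, rfl⟩ := (KaehlerDifferential.exact_mapBaseChange_map k K F ω).1 hω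
    clear hω
    induction t using TensorProduct.induction_on with
    | zero => rw [map_zero]; exact Submodule.zero_mem _
    | add a b ha hb => rw [map_add]; exact add_mem ha hb
    | tmul a b =>
      rw [KaehlerDifferential.mapBaseChange_tmul]
      refine Submodule.smul_mem _ _ ?_
      induction b using differentials_induction with
      | hD y =>
        rw [KaehlerDifferential.map_D]
        exact D_mem_diffSpan_of_mem_adjoin y.2
      | hadd b c hb hc => rw [map_add]; exact add_mem hb hc
      | hsmul f b hb =>
        rw [map_smul]
        exact (diffSpan k S).smul_mem (f : F) hb
  refine ⟨g, fun s hs => ?_, fun ω hω => hker ?_⟩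
  · rw [hg]
    exact smul_algebraMap' (σ ^ n) (⟨s, IntermediateField.subset_adjoin k S hs⟩ : K)
  · have h1 : π ω ∈ diffSpan K (σ ^ n • T) := by
      rw [← hgT, ← hπ]
      exact Submodule.mem_map_of_mem hω.1
    have h2 : π ω ∈ diffSpan K B := by
      have : π ω ∈ diffSpan K (S ∪ B) := hπ (S ∪ B) ▸ Submodule.mem_map_of_mem hω.2
      refine Submodule.span_le.2 ?_ this
      rintro _ ⟨y, hy | hy, rfl⟩
      · have : D K F y = 0 := Derivation.map_algebraMap (D K F)
          (⟨y, IntermediateField.subset_adjoin k S hy⟩ : K)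
        rw [this]
        exact Submodule.zero_mem _
      · exact D_mem_diffSpan hy
    have h3 : π ω = actOnDifferentials (σ ^ n) (actOnDifferentials (σ ^ n)⁻¹ (π ω)) := by
      rw [← actOnDifferentials_mul, mul_inv_cancel, actOnDifferentials_one]
    rw [h3] at h1 h2
    rw [LinearMap.mem_ker, h3, hn _ (actOnDifferentials_mem_diffSpan_iff.1 h1) h2, map_zero]

theorem exists_disjoint (hF : Algebra.trdeg k F = Cardinal.aleph0) {T B : Set F}
    (hT : T.Finite) (hB : B.Finite) :
    ∃ g : FieldAut k F, Disjoint (diffSpan k B) (diffSpan k (g • T)) := by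
  obtain ⟨g, -, hg⟩ := exists_fixing_inf_le hF Set.finite_empty hT hB
  refine ⟨g, disjoint_iff_inf_le.2 ?_⟩
  rw [Set.empty_union, inf_comm] at hg
  refine hg.trans (le_of_eq ?_)
  rw [diffSpan, Set.image_empty, Submodule.span_empty]

variable [IsAlgClosed k]

/-- The pointwise stabilizers of two independent finite sets generate the whole group. -/
theorem eq_top_of_disjoint (hF : Algebra.trdeg k F = Cardinal.aleph0) {S S' : Set F}
    (hS : S.Finite) (hS' : S'.Finite) (h : Disjoint (diffSpan k S') (diffSpan k S))
    {U : Subgroup (FieldAut k F)} (hU : ∀ g : FieldAut k F, (∀ s ∈ S, g • s = s) → g ∈ U)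
    (hU' : ∀ g : FieldAut k F, (∀ s ∈ S', g • s = s) → g ∈ U) : U = ⊤ := by
  -- Such a `p` agrees on `S` with some `q` fixing `S'`, so it is a product of elements of the two
  -- stabilizers.
  have key (p : FieldAut k F) (hp : Disjoint (diffSpan k S') (diffSpan k (p • S))) : p ∈ U := by
    obtain ⟨q, hq, hqp⟩ := exists_fixing_of_disjoint hF hS' hS p h hp
    have : q⁻¹ * p ∈ U := hU _ fun s hs => by rw [mul_smul, ← hqp s hs, inv_smul_smul]
    simpa using U.mul_mem (hU' q hq) this
  refine eq_top_iff.2 fun g _ => ?_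
  -- With `pS` independent of both `S'` and `gS'`, both `p` and `g⁻¹p` satisfy `key`, and their
  -- quotient is `g`.
  obtain ⟨p, hp⟩ := exists_disjoint hF hS (hS'.union (hS'.smul_set (a := g)))
  have h1 := key p (hp.mono_left (diffSpan_mono Set.subset_union_left))
  have h2 : g⁻¹ * p ∈ U := by
    refine key _ ((disjoint_diffSpan_smul_iff (g := g)).1 ?_)
    rw [← mul_smul, mul_inv_cancel_left]
    exact hp.mono_left (diffSpan_mono Set.subset_union_right)
  simpa using U.mul_mem h1 (U.inv_mem h2)

/-- An open normal subgroup is everything. -/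
theorem eq_top_of_isOpen_of_normal (hF : Algebra.trdeg k F = Cardinal.aleph0)
    {U : Subgroup (FieldAut k F)} (hU : IsOpen (U : Set (FieldAut k F))) (hn : U.Normal) :
    U = ⊤ := by
  obtain ⟨S, hS⟩ := (isOpen_subgroup_iff U).1 hU
  obtain ⟨g, hg⟩ := exists_disjoint hF S.finite_toSet S.finite_toSet
  refine eq_top_of_disjoint hF (S.finite_toSet.smul_set (a := g)) S.finite_toSet hg
    (fun h hh => ?_) hS
  have : g⁻¹ * h * g ∈ U := hS _ fun s hs => by
    rw [mul_smul, mul_smul, hh _ (Set.smul_mem_smul_set hs), inv_smul_smul]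
  simpa [mul_assoc] using hn.conj_mem _ this g

/-- A proper open subgroup leaves invariant a non-zero finite-dimensional space of differentials. -/
theorem exists_invariant_of_isOpen (hF : Algebra.trdeg k F = Cardinal.aleph0)
    {U : Subgroup (FieldAut k F)} (hU : IsOpen (U : Set (FieldAut k F))) (hne : U ≠ ⊤) :
    ∃ W : Submodule F (Ω[F⁄k]), W ≠ ⊥ ∧ FiniteDimensional F W ∧
      ∀ u ∈ U, ∀ ω ∈ W, actOnDifferentials u ω ∈ W := by
  obtain ⟨S₀, hS₀⟩ := (isOpen_subgroup_iff U).1 hU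
  obtain ⟨S, hS, hfin⟩ : ∃ S : Set F, (∀ h : FieldAut k F, (∀ x ∈ S, h • x = x) → h ∈ U) ∧
    S.Finite := ⟨S₀, hS₀, S₀.finite_toSet⟩
  let V (v : FieldAut k F) : Submodule F (Ω[F⁄k]) := diffSpan k (v • S)
  let d (v w : FieldAut k F) : ℕ := Module.finrank F (V v ⊓ V w : Submodule F (Ω[F⁄k]))
  have (v : FieldAut k F) : FiniteDimensional F (V v) := finiteDimensional_diffSpan hfin.smul_set
  have hVmul (g v : FieldAut k F) (ω : Ω[F⁄k]) : actOnDifferentials g ω ∈ V (g * v) ↔ ω ∈ V v := by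
    change _ ∈ diffSpan k ((g * v) • S) ↔ _
    rw [mul_smul]
    exact actOnDifferentials_mem_diffSpan_iff
  have hd (g v w : FieldAut k F) : d (g * v) (g * w) = d v w :=
    (finrank_eq_of_semilinear (MulSemiringAction.toRingEquiv _ F g) (differentialsEquiv g)
      (actOnDifferentials_smul g) fun ω => and_congr (hVmul g v ω) (hVmul g w ω)).symm
  -- By translation invariance of `d`, this minimum bounds `d v w` below for all `v`, `w` in `U`.
  obtain ⟨u₀, hu₀, hmin⟩ : ∃ u₀ ∈ U, ∀ u ∈ U, d 1 u₀ ≤ d 1 u := by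
    obtain ⟨u₀, hu₀, h⟩ := (measure (d 1)).wf.has_min (U : Set (FieldAut k F)) ⟨1, U.one_mem⟩
    exact ⟨u₀, hu₀, fun u hu => not_lt.1 (h u hu)⟩
  have hmin' (v w : FieldAut k F) (hv : v ∈ U) (hw : w ∈ U) : d 1 u₀ ≤ d v w := by
    have := hd v 1 (v⁻¹ * w)
    rw [mul_one, mul_inv_cancel_left] at this
    exact this ▸ hmin _ (U.mul_mem (U.inv_mem hv) hw)
  have hV1 : V 1 = diffSpan k S := by simp [V]
  have hW (v : FieldAut k F) (hv : v ∈ U) : V 1 ⊓ V u₀ ≤ V v := by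
    -- Moving `u₀S` by a generic `g` fixing `S` forces `V (g * u₀) ⊓ V v` and `V (g * u₀) ⊓ V u₀`
    -- into `V 1`. Minimality turns these inclusions into equalities with `V (g * u₀) ⊓ V 1`, which
    -- is then `V 1 ⊓ V u₀`.
    obtain ⟨g, hgS, hg⟩ := exists_fixing_inf_le hF hfin (hfin.smul_set (a := u₀))
      ((hfin.smul_set (a := v)).union (hfin.smul_set (a := u₀)))
    have hgU : g ∈ U := hS g hgS
    rw [← mul_smul, ← hV1] at hg
    have hVg : V g = V 1 := by
      change diffSpan k (g • S) = diffSpan k ((1 : FieldAut k F) • S)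
      rw [one_smul]
      congr 1
      exact (Set.image_congr hgS).trans (Set.image_id S)
    have hu : g * u₀ ∈ U := U.mul_mem hgU hu₀
    have hdu : d (g * u₀) 1 = d 1 u₀ := by
      have : d g (g * u₀) = d 1 u₀ := by simpa using hd g 1 u₀
      rw [← this]
      change Module.finrank F (V _ ⊓ V 1 : Submodule F (Ω[F⁄k])) =
        Module.finrank F (V g ⊓ V _ : Submodule F (Ω[F⁄k]))
      rw [hVg, inf_comm]
    have heq (w : FieldAut k F) (hw : w ∈ U) (hle : V w ≤ diffSpan k (S ∪ (v • S ∪ u₀ • S))) :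
        V (g * u₀) ⊓ V w = V (g * u₀) ⊓ V 1 :=
      Submodule.eq_of_le_of_finrank_le
        (le_inf inf_le_left ((inf_le_inf_left _ hle).trans hg))
        (hdu.le.trans (hmin' _ _ hu hw))
    have h0 := heq u₀ hu₀
      (diffSpan_mono (Set.subset_union_right.trans Set.subset_union_right))
    have h1 := heq v hv (diffSpan_mono (Set.subset_union_left.trans Set.subset_union_right))
    have h2 : V (g * u₀) ⊓ V 1 = V 1 ⊓ V u₀ :=
      Submodule.eq_of_le_of_finrank_le (le_inf inf_le_right (h0 ▸ inf_le_right)) hdu.ge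
    rw [← h2, ← h1]
    exact inf_le_right
  refine ⟨V 1 ⊓ V u₀, fun hbot => hne ?_, inferInstance, fun u hu ω hω => ?_⟩
  -- A zero intersection makes `S` and `u₀S` independent, and `U` contains both stabilizers, the
  -- second by conjugation with `u₀`.
  · refine eq_top_of_disjoint hF hfin (hfin.smul_set (a := u₀))
      (disjoint_iff.2 (by rw [inf_comm, ← hV1]; exact hbot)) hS fun g hg => ?_
    have : u₀⁻¹ * g * u₀ ∈ U := hS _ fun s hs => by
      rw [mul_smul, mul_smul, hg _ (Set.smul_mem_smul_set hs), inv_smul_smul]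
    simpa [mul_assoc] using U.mul_mem (U.mul_mem hu₀ this) (U.inv_mem hu₀)
  · have key (v : FieldAut k F) (hv : v ∈ U) : actOnDifferentials u ω ∈ V v := by
      have := (hVmul u (u⁻¹ * v) ω).2 (hW _ (U.mul_mem (U.inv_mem hu) hv) hω)
      rwa [mul_inv_cancel_left] at this
    exact ⟨key 1 U.one_mem, key u₀ hu₀⟩

end Independence

end FieldAut

/-! ### The modular character of a commensurated subgroup -/

namespace Subgroup

variable {G : Type*} [Group G]

/-- The generalized index `[B : A ∩ B] / [A : A ∩ B]` of commensurable subgroups. -/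
noncomputable def indexRatio (A B : Subgroup G) : ℚ := A.relIndex B / B.relIndex A

theorem indexRatio_self (A : Subgroup G) : A.indexRatio A = 1 := by simp [indexRatio]

/-- With `E = A ⊓ B ⊓ C` of finite index in all three groups, each ratio becomes a quotient of
indices of `E`, and the product telescopes. -/
theorem indexRatio_mul {A B C : Subgroup G} (hBA : B.relIndex A ≠ 0)
    (hAB : A.relIndex B ≠ 0) (hCA : C.relIndex A ≠ 0) (hAC : A.relIndex C ≠ 0)
    (hCB : C.relIndex B ≠ 0) (hBC : B.relIndex C ≠ 0) :
    A.indexRatio B * B.indexRatio C = A.indexRatio C := by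
  let E := A ⊓ B ⊓ C
  have key (X Y : Subgroup G) (hX : E ≤ X) (hY : E ≤ Y) (h0 : E.relIndex X ≠ 0)
      (h0' : E.relIndex Y ≠ 0) : X.indexRatio Y = E.relIndex Y / E.relIndex X := by
    have h1 : E.relIndex (X ⊓ Y) * Y.relIndex X = E.relIndex X := by
      rw [← inf_relIndex_left X Y]
      exact relIndex_mul_relIndex _ _ _ (le_inf hX hY) inf_le_left
    have h2 : E.relIndex (X ⊓ Y) * X.relIndex Y = E.relIndex Y := by
      rw [← inf_relIndex_right X Y]
      exact relIndex_mul_relIndex _ _ _ (le_inf hX hY) inf_le_right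
    have h3 : E.relIndex (X ⊓ Y) ≠ 0 := fun h => h0 (by rw [← h1, h, zero_mul])
    rw [indexRatio, ← h1, ← h2, Nat.cast_mul, Nat.cast_mul,
      mul_div_mul_left _ _ (Nat.cast_ne_zero.2 h3)]
  have hA : E.relIndex A ≠ 0 :=
    relIndex_inf_ne_zero (relIndex_inf_ne_zero (by simp) hBA) hCA
  have hB : E.relIndex B ≠ 0 :=
    relIndex_inf_ne_zero (relIndex_inf_ne_zero hAB (by simp)) hCB
  have hC : E.relIndex C ≠ 0 :=
    relIndex_inf_ne_zero (relIndex_inf_ne_zero hAC hBC) (by simp)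
  have hEA : E ≤ A := inf_le_left.trans inf_le_left
  have hEB : E ≤ B := inf_le_left.trans inf_le_right
  have hEC : E ≤ C := inf_le_right
  rw [key A B hEA hEB hA hB, key B C hEB hEC hB hC, key A C hEA hEC hA hC, mul_comm]
  exact div_mul_div_cancel₀ (Nat.cast_ne_zero.2 hB)

theorem indexRatio_map_conj (g : G) (A B : Subgroup G) :
    (A.map (MulAut.conj g).toMonoidHom).indexRatio (B.map (MulAut.conj g).toMonoidHom) =
      A.indexRatio B := by
  have hinj : Function.Injective (MulAut.conj g).toMonoidHom := (MulAut.conj g).injective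
  rw [indexRatio, relIndex_map_map_of_injective _ _ hinj, relIndex_map_map_of_injective _ _ hinj]
  rfl

/-- The modular character of a subgroup commensurable with all its conjugates. -/
noncomputable def modularCharacter (U : Subgroup G)
    (hU : ∀ g h : G, (U.map (MulAut.conj g).toMonoidHom).relIndex
      (U.map (MulAut.conj h).toMonoidHom) ≠ 0) : G →* ℚ where
  toFun g := U.indexRatio (U.map (MulAut.conj g).toMonoidHom)
  map_one' := by
    have : U.map (MulAut.conj (1 : G)).toMonoidHom = U := by
      rw [map_one]
      exact U.map_id
    rw [this, indexRatio_self]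
  map_mul' g h := by
    have h1 : U.map (MulAut.conj (1 : G)).toMonoidHom = U := by
      rw [map_one]
      exact U.map_id
    have hgh : U.map (MulAut.conj (g * h)).toMonoidHom =
        (U.map (MulAut.conj h).toMonoidHom).map (MulAut.conj g).toMonoidHom := by
      rw [map_map, map_mul]
      rfl
    have h2 := hU 1
    have h3 := fun g => hU g 1
    rw [h1] at h2 h3
    rw [← indexRatio_map_conj g U (U.map (MulAut.conj h).toMonoidHom), ← hgh]
    exact (indexRatio_mul (h3 _) (h2 _) (h3 _) (h2 _) (hU _ _) (hU _ _)).symm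

theorem modularCharacter_apply (U : Subgroup G)
    (hU : ∀ g h : G, (U.map (MulAut.conj g).toMonoidHom).relIndex
      (U.map (MulAut.conj h).toMonoidHom) ≠ 0) (g : G) :
    U.modularCharacter hU g = U.indexRatio (U.map (MulAut.conj g).toMonoidHom) := rfl

theorem modularCharacter_of_mem (U : Subgroup G)
    (hU : ∀ g h : G, (U.map (MulAut.conj g).toMonoidHom).relIndex
      (U.map (MulAut.conj h).toMonoidHom) ≠ 0) {g : G} (hg : g ∈ U) :
    U.modularCharacter hU g = 1 := by
  have : U.map (MulAut.conj g).toMonoidHom = U := by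
    ext x
    refine ⟨?_, fun hx => ⟨g⁻¹ * x * g, U.mul_mem (U.mul_mem (U.inv_mem hg) hx) hg, ?_⟩⟩
    · rintro ⟨y, hy, rfl⟩
      exact U.mul_mem (U.mul_mem hg hy) (U.inv_mem hg)
    · simp [mul_assoc]
  rw [modularCharacter_apply, this, indexRatio_self]

end Subgroup

/-- The multiplicative group of the rational numbers contains no cyclic subgroup with `2` and `3`. -/
theorem Rat.two_three_notMem_zpowers (a : ℚˣ) (h2 : Units.mk0 2 two_ne_zero ∈ Subgroup.zpowers a)
    (h3 : Units.mk0 3 three_ne_zero ∈ Subgroup.zpowers a) : False := by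
  obtain ⟨i, hi⟩ := Subgroup.mem_zpowers_iff.1 h2
  obtain ⟨j, hj⟩ := Subgroup.mem_zpowers_iff.1 h3
  have h : (2 : ℚ) ^ j = 3 ^ i := by
    have h' : (Units.mk0 2 two_ne_zero : ℚˣ) ^ j = Units.mk0 3 three_ne_zero ^ i := by
      rw [← hi, ← hj, ← zpow_mul, ← zpow_mul, mul_comm]
    simpa using congrArg Units.val h'
  have h0 : j = 0 := by
    have := congrArg (padicValRat 2) h
    rw [padicValRat.zpow, padicValRat.zpow] at this
    have e2 : padicValRat 2 (2 : ℚ) = 1 := padicValRat.self (by norm_num)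
    have e3 : padicValRat 2 (3 : ℚ) = 0 := by
      have : padicValRat 2 ((3 : ℕ) : ℚ) = 0 := by
        rw [padicValRat.of_nat, padicValNat.eq_zero_of_not_dvd (by norm_num)]
        rfl
      exact_mod_cast this
    rw [e2, e3] at this
    simpa using this
  rw [h0, zpow_zero] at hj
  exact absurd (congrArg Units.val hj) (by norm_num)

/-! ### Finite transcendence degree -/

namespace FieldAut

section FiniteTranscendenceDegree

variable {k F : Type*} [Field k] [Field F] [Algebra k F]

/-- The orbits of the pointwise stabilizer of `S` on elements algebraic over `S` are finite. -/
theorem finite_orbit_of_isAlgebraic {S : Set F} {y : F}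
    (hy : IsAlgebraic (Algebra.adjoin k S) y) :
    (MulAction.orbit (fixingSubgroup (FieldAut k F) S) y).Finite := by
  obtain ⟨p, hp, hpy⟩ := hy
  have hinj : Function.Injective (algebraMap (Algebra.adjoin k S) F) := Subtype.val_injective
  have hp' : p.map (algebraMap (Algebra.adjoin k S) F) ≠ 0 := (Polynomial.map_ne_zero_iff hinj).2 hp
  refine (Polynomial.finite_setOfPred_isRoot hp').subset ?_
  rintro _ ⟨⟨h, hh⟩, rfl⟩
  have hfix (a : Algebra.adjoin k S) : h • (a : F) = a := by
    obtain ⟨a, ha⟩ := a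
    induction ha using Algebra.adjoin_induction with
    | mem s hs => exact (mem_fixingSubgroup_iff _).1 hh s hs
    | algebraMap r => exact smul_algebraMap' h r
    | add a b _ _ ha hb => exact (smul_add _ _ _).trans (congrArg₂ _ ha hb)
    | mul a b _ _ ha hb => exact (smul_mul' _ _ _).trans (congrArg₂ _ ha hb)
  change Polynomial.IsRoot _ (h • y)
  rw [Polynomial.IsRoot, Polynomial.eval_map_algebraMap]
  let f : F →ₐ[Algebra.adjoin k S] F :=
    { (MulSemiringAction.toRingHom (FieldAut k F) F h) with commutes' := hfix }
  have : Polynomial.aeval (f y) p = f (Polynomial.aeval y p) := Polynomial.aeval_algHom_apply f y p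
  rw [hpy, map_zero] at this
  exact this

/-- The stabilizer of `T` is a finite intersection of point stabilizers, each of finite index
because the corresponding orbit is finite. This gives the commensurability needed for the modular
character. -/
theorem relIndex_fixingSubgroup_ne_zero {S T : Set F} (hT : T.Finite)
    (h : ∀ y ∈ T, IsAlgebraic (Algebra.adjoin k S) y) :
    (fixingSubgroup (FieldAut k F) T).relIndex (fixingSubgroup (FieldAut k F) S) ≠ 0 := by
  have : Finite T := hT
  have heq : fixingSubgroup (FieldAut k F) T =
      ⨅ y : T, MulAction.stabilizer (FieldAut k F) (y : F) := by
    ext g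
    simp [mem_fixingSubgroup_iff, Subgroup.mem_iInf]
  rw [heq]
  refine Subgroup.relIndex_iInf_ne_zero fun y => ?_
  change (MulAction.stabilizer (fixingSubgroup (FieldAut k F) S) (y : F)).index ≠ 0
  rw [MulAction.index_stabilizer, Ne, Set.ncard_eq_zero (finite_orbit_of_isAlgebraic (h y y.2))]
  exact (MulAction.nonempty_orbit _).ne_empty

/-- Replacing an element of a finite transcendence basis by one over which it is radical gives a
transcendence basis. -/
theorem isTranscendenceBasis_update {ι : Type*} [Finite ι] [DecidableEq ι] {x : ι → F}
    (hx : IsTranscendenceBasis k x) (i : ι) {p : ℕ} (hp : 0 < p) {z : F}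
    (hz : x i ^ p ∈ Algebra.adjoin k (Set.range (Function.update x i z))) :
    IsTranscendenceBasis k (Function.update x i z) := by
  have halg : Algebra.IsAlgebraic (Algebra.adjoin k (Set.range (Function.update x i z))) F := by
    refine ⟨fun a => IsAlgebraic.adjoin_of_forall_isAlgebraic (s := Set.range x) ?_
      (hx.isAlgebraic.isAlgebraic a)⟩
    rintro _ ⟨⟨j, rfl⟩, -⟩
    by_cases hj : j = i
    · subst hj
      exact IsAlgebraic.of_pow hp (isAlgebraic_algebraMap (⟨_, hz⟩ : Algebra.adjoin k _))
    · exact isAlgebraic_algebraMap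
        (⟨x j, Algebra.subset_adjoin ⟨j, by simp [hj]⟩⟩ :
          Algebra.adjoin k (Set.range (Function.update x i z)))
  -- A finite family over which `F` is algebraic is independent once its size does not exceed the
  -- transcendence degree.
  exact Algebra.IsAlgebraic.isTranscendenceBasis_of_lift_le_trdeg_of_finite k _
    hx.lift_cardinalMk_eq_trdeg.le

/-- The index is the size of the orbit of `x i`, which consists of all `p` roots of `X ^ p - x i ^
p`: replacing `x i` by any such root gives another transcendence basis, so an automorphism realizes
the replacement. -/
theorem relIndex_fixingSubgroup_update_pow [CharZero k] [IsAlgClosed F] {ι : Type*} [Finite ι]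
    [DecidableEq ι] {x : ι → F} (hx : IsTranscendenceBasis k x) (i : ι) {p : ℕ} (hp : 0 < p) :
    (fixingSubgroup (FieldAut k F) (Set.range x)).relIndex
      (fixingSubgroup (FieldAut k F) (Set.range (Function.update x i (x i ^ p)))) = p := by
  let H := fixingSubgroup (FieldAut k F) (Set.range (Function.update x i (x i ^ p)))
  have hH (g : FieldAut k F) : g ∈ H ↔ g • (x i ^ p) = x i ^ p ∧ ∀ j, j ≠ i → g • x j = x j := by
    rw [mem_fixingSubgroup_iff]
    refine ⟨fun h => ⟨h _ ⟨i, by simp⟩, fun j hj => h _ ⟨j, by simp [hj]⟩⟩, ?_⟩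
    rintro ⟨h1, h2⟩ _ ⟨j, rfl⟩
    by_cases hj : j = i
    · subst hj
      simpa using h1
    · simpa [hj] using h2 j hj
  have heq : (fixingSubgroup (FieldAut k F) (Set.range x)).relIndex H =
      (MulAction.stabilizer H (x i)).index := by
    change Subgroup.index _ = _
    congr 1
    ext ⟨g, hg⟩
    rw [Subgroup.mem_subgroupOf, mem_fixingSubgroup_iff, MulAction.mem_stabilizer_iff]
    refine ⟨fun h => h _ ⟨i, rfl⟩, ?_⟩
    rintro h _ ⟨j, rfl⟩
    by_cases hj : j = i
    · exact hj ▸ h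
    · exact ((hH g).1 hg).2 j hj
  have hxi : x i ≠ 0 := hx.1.ne_zero i
  have hpF : (p : F) ≠ 0 := by
    have : CharZero F := charZero_of_injective_algebraMap (algebraMap k F).injective
    exact Nat.cast_ne_zero.2 hp.ne'
  have horb : MulAction.orbit H (x i) =
      (Polynomial.X ^ p - Polynomial.C (x i ^ p) : Polynomial F).rootSet F := by
    ext z
    rw [Polynomial.mem_rootSet_of_ne (Polynomial.X_pow_sub_C_ne_zero hp _)]
    simp only [map_sub, map_pow, Polynomial.aeval_X, Polynomial.aeval_C, Algebra.algebraMap_self,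
      RingHom.id_apply, sub_eq_zero]
    constructor
    · rintro ⟨⟨g, hg⟩, rfl⟩
      change (g • x i) ^ p = _
      rw [← smul_pow', ((hH g).1 hg).1]
    · intro hz
      have hb : IsTranscendenceBasis k (Function.update x i z) :=
        isTranscendenceBasis_update hx i hp
          (hz ▸ pow_mem (Algebra.subset_adjoin (Set.mem_range.2 ⟨i, by simp⟩)) p)
      obtain ⟨e, he⟩ := IsAlgClosed.exists_algEquiv_of_isTranscendenceBasis hx hb
      refine ⟨⟨ofAlgEquiv e, (hH _).2 ⟨?_, fun j hj => ?_⟩⟩, ?_⟩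
      · rw [ofAlgEquiv_smul, map_pow, he, Function.update_self, hz]
      · rw [ofAlgEquiv_smul, he, Function.update_of_ne hj]
      · exact (he i).trans (Function.update_self _ _ _)
  rw [heq, MulAction.index_stabilizer, horb, Set.ncard_eq_toFinset_card', Set.toFinset_card,
    Polynomial.card_rootSet_eq_natDegree
      (Polynomial.separable_X_pow_sub_C _ hpF (pow_ne_zero _ hxi)) (IsAlgClosed.splits _),
    Polynomial.natDegree_X_pow_sub_C]

/-- If there is a finite non-empty transcendence basis, every automorphism lies in a proper open
subgroup. -/
theorem properOpenUnion_eq_univ_of_finite [CharZero k] [IsAlgClosed F] {ι : Type*} [Finite ι]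
    {x : ι → F} (hx : IsTranscendenceBasis k x) (i : ι) : properOpenUnion k F = Set.univ := by
  classical
  let U := fixingSubgroup (FieldAut k F) (Set.range x)
  have hconj (g : FieldAut k F) : U.map (MulAut.conj g).toMonoidHom =
      fixingSubgroup (FieldAut k F) (g • Set.range x) :=
    (SubMulAction.fixingSubgroup_smul_eq_fixingSubgroup_map_conj _ _).symm
  have hbasis (g : FieldAut k F) (y : F) : IsAlgebraic (Algebra.adjoin k (g • Set.range x)) y := by
    have := (AlgEquiv.isTranscendenceBasis (show F ≃ₐ[k] F from g) hx).isAlgebraic.isAlgebraic y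
    rwa [Set.range_comp] at this
  have hU (g h : FieldAut k F) : (U.map (MulAut.conj g).toMonoidHom).relIndex
      (U.map (MulAut.conj h).toMonoidHom) ≠ 0 := by
    rw [hconj, hconj]
    exact relIndex_fixingSubgroup_ne_zero ((Set.finite_range x).smul_set) fun y _ => hbasis h y
  let χ := U.modularCharacter hU
  -- The automorphism raising one basis element to its `p`-th power, and fixing the others, has
  -- character `p / 1`.
  have hχ (p : ℕ) (hp : 0 < p) : ∃ g, χ g = p := by
    have hy : IsTranscendenceBasis k (Function.update x i (x i ^ p)) :=
      isTranscendenceBasis_update hx i hp (Algebra.subset_adjoin (Set.mem_range.2 ⟨i, by simp⟩))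
    obtain ⟨e, he⟩ := IsAlgClosed.exists_algEquiv_of_isTranscendenceBasis hx hy
    refine ⟨ofAlgEquiv e, ?_⟩
    have hS : ofAlgEquiv e • Set.range x = Set.range (Function.update x i (x i ^ p)) := by
      rw [← Set.image_smul, ← Set.range_comp]
      exact congrArg Set.range (funext he)
    have hle : U ≤ fixingSubgroup (FieldAut k F) (Set.range (Function.update x i (x i ^ p))) := by
      intro g hg
      rw [mem_fixingSubgroup_iff] at hg ⊢
      rintro _ ⟨j, rfl⟩
      by_cases hj : j = i
      · subst hj
        rw [Function.update_self, smul_pow', hg _ ⟨j, rfl⟩]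
      · rw [Function.update_of_ne hj, hg _ ⟨j, rfl⟩]
    rw [Subgroup.modularCharacter_apply, hconj, hS, Subgroup.indexRatio,
      relIndex_fixingSubgroup_update_pow hx i hp, Subgroup.relIndex_eq_one.2 hle, Nat.cast_one,
      div_one]
  refine Set.eq_univ_of_forall fun σ => ?_
  -- This preimage is open because `χ` is trivial on `U`, and proper because `χ` takes the values
  -- `2` and `3`, which lie in no common cyclic subgroup.
  refine ⟨(Subgroup.zpowers (χ.toHomUnits σ)).comap χ.toHomUnits, ?_, fun htop => ?_,
    Subgroup.mem_zpowers _⟩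
  · refine (isOpen_subgroup_iff _).2 ⟨(Set.finite_range x).toFinset, fun h hh => ?_⟩
    have hhU : h ∈ U := (mem_fixingSubgroup_iff _).2 fun y hy => hh y (by simpa using hy)
    have : χ.toHomUnits h = 1 := Units.ext (U.modularCharacter_of_mem hU hhU)
    rw [Subgroup.mem_comap, this]
    exact Subgroup.one_mem _
  · obtain ⟨g₂, h₂⟩ := hχ 2 two_pos
    obtain ⟨g₃, h₃⟩ := hχ 3 three_pos
    have m₂ : g₂ ∈ (Subgroup.zpowers (χ.toHomUnits σ)).comap χ.toHomUnits := htop ▸ trivial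
    have m₃ : g₃ ∈ (Subgroup.zpowers (χ.toHomUnits σ)).comap χ.toHomUnits := htop ▸ trivial
    refine Rat.two_three_notMem_zpowers (χ.toHomUnits σ) ?_ ?_
    · convert! Subgroup.mem_comap.1 m₂
      exact Units.ext (by simpa using h₂.symm)
    · convert! Subgroup.mem_comap.1 m₃
      exact Units.ext (by simpa using h₃.symm)

/-- If the transcendence degree is finite and non-zero, every automorphism lies in a proper open
subgroup. -/
theorem properOpenUnion_eq_univ [CharZero k] [IsAlgClosed F] (h1 : 1 ≤ Algebra.trdeg k F)
    (hF : Algebra.trdeg k F < Cardinal.aleph0) : properOpenUnion k F = Set.univ := by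
  obtain ⟨s, hs⟩ := exists_isTranscendenceBasis k F
  have hcard := hs.cardinalMk_eq_trdeg
  have : Finite s := Cardinal.lt_aleph0_iff_finite.1 (hcard ▸ hF)
  obtain ⟨i⟩ : Nonempty s := Cardinal.mk_ne_zero_iff.1 fun h => by
    rw [← hcard, h] at h1
    exact absurd h1 (by simp)
  exact properOpenUnion_eq_univ_of_finite hs i

end FiniteTranscendenceDegree

end FieldAut

namespace FieldAut

/-! ### Invariant spaces of forms -/

section Forms

variable {k F : Type*} [Field k] [Field F] [Algebra k F]

theorem forms_induction {q : ℕ} {M : Type*} [AddCommGroup M] [Module F M] {p : ⋀[F]^q M → Prop}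
    (ω : ⋀[F]^q M) (hι : ∀ v, p (exteriorPower.ιMulti F q v))
    (hzero : p 0) (hadd : ∀ a b, p a → p b → p (a + b)) (hsmul : ∀ (f : F) a, p a → p (f • a)) :
    p ω := by
  have hω : ω ∈ Submodule.span F (Set.range (exteriorPower.ιMulti F q (M := M))) := by
    rw [exteriorPower.ιMulti_span]
    trivial
  refine Submodule.span_induction (p := fun ω _ => p ω) ?_ hzero (fun _ _ _ _ => hadd _ _)
    (fun f a _ => hsmul f a) hω
  rintro _ ⟨v, rfl⟩
  exact hι v

theorem actOnForms_mul (g h : FieldAut k F) {q : ℕ} (ω : ⋀[F]^q Ω[F⁄k]) :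
    actOnForms (g * h) q ω = actOnForms g q (actOnForms h q ω) := by
  induction ω using forms_induction with
  | hι v => simp only [actOnForms_ιMulti, actOnDifferentials_mul]
  | hzero => simp only [map_zero]
  | hadd a b ha hb => simp only [map_add, ha, hb]
  | hsmul f a ha => simp only [actOnForms_smul, ha, mul_smul]

theorem actOnForms_one {q : ℕ} (ω : ⋀[F]^q Ω[F⁄k]) : actOnForms (1 : FieldAut k F) q ω = ω := by
  induction ω using forms_induction with
  | hι v => simp only [actOnForms_ιMulti, actOnDifferentials_one]
  | hzero => simp only [map_zero]
  | hadd a b ha hb => simp only [map_add, ha, hb]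
  | hsmul f a ha => simp only [actOnForms_smul, ha, one_smul]

/-- The action of an automorphism on forms, as an additive bijection. -/
noncomputable def formsEquiv (g : FieldAut k F) (q : ℕ) : ⋀[F]^q Ω[F⁄k] ≃+ ⋀[F]^q Ω[F⁄k] where
  __ := actOnForms g q
  invFun := actOnForms g⁻¹ q
  left_inv ω := by
    change actOnForms g⁻¹ q (actOnForms g q ω) = ω
    rw [← actOnForms_mul, inv_mul_cancel, actOnForms_one]
  right_inv ω := by
    change actOnForms g q (actOnForms g⁻¹ q ω) = ω
    rw [← actOnForms_mul, mul_inv_cancel, actOnForms_one]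

theorem exists_finset_fixing_differential (ω : Ω[F⁄k]) :
    ∃ S : Finset F, ∀ g : FieldAut k F, (∀ x ∈ S, g • x = x) → actOnDifferentials g ω = ω := by
  classical
  induction ω using differentials_induction with
  | hD x => exact ⟨{x}, fun g hg => by rw [actOnDifferentials_D, hg x (Finset.mem_singleton_self x)]⟩
  | hadd a b ha hb =>
    obtain ⟨S, hS⟩ := ha
    obtain ⟨T, hT⟩ := hb
    exact ⟨S ∪ T, fun g hg => by
      rw [map_add, hS g fun x hx => hg x (Finset.mem_union_left _ hx),
        hT g fun x hx => hg x (Finset.mem_union_right _ hx)]⟩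
  | hsmul f a ha =>
    obtain ⟨S, hS⟩ := ha
    exact ⟨insert f S, fun g hg => by
      rw [actOnDifferentials_smul, hg f (Finset.mem_insert_self f S),
        hS g fun x hx => hg x (Finset.mem_insert_of_mem hx)]⟩

theorem exists_finset_fixing_form {q : ℕ} (ω : ⋀[F]^q Ω[F⁄k]) :
    ∃ S : Finset F, ∀ g : FieldAut k F, (∀ x ∈ S, g • x = x) → actOnForms g q ω = ω := by
  classical
  induction ω using forms_induction with
  | hι v =>
    choose S hS using fun i => exists_finset_fixing_differential (v i)
    refine ⟨Finset.univ.biUnion S, fun g hg => ?_⟩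
    rw [actOnForms_ιMulti]
    congr 1
    ext1 i
    exact hS i g fun x hx => hg x (Finset.mem_biUnion.2 ⟨i, Finset.mem_univ i, hx⟩)
  | hzero => exact ⟨∅, fun g _ => map_zero _⟩
  | hadd a b ha hb =>
    obtain ⟨S, hS⟩ := ha
    obtain ⟨T, hT⟩ := hb
    exact ⟨S ∪ T, fun g hg => by
      rw [map_add, hS g fun x hx => hg x (Finset.mem_union_left _ hx),
        hT g fun x hx => hg x (Finset.mem_union_right _ hx)]⟩
  | hsmul f a ha =>
    obtain ⟨S, hS⟩ := ha
    exact ⟨insert f S, fun g hg => by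
      rw [actOnForms_smul, hg f (Finset.mem_insert_self f S),
        hS g fun x hx => hg x (Finset.mem_insert_of_mem hx)]⟩

/-- The subgroup of the automorphisms leaving a space of forms invariant. -/
def formsStabilizer {q : ℕ} (V : Submodule F (⋀[F]^q Ω[F⁄k])) : Subgroup (FieldAut k F) where
  carrier := {g | ∀ ω, actOnForms g q ω ∈ V ↔ ω ∈ V}
  mul_mem' := fun {g h} hg hh ω => by rw [actOnForms_mul, hg, hh]
  one_mem' := fun ω => by rw [actOnForms_one]
  inv_mem' := fun {g} hg ω => by
    rw [← hg, ← actOnForms_mul, mul_inv_cancel, actOnForms_one]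

/-- Finite dimension upgrades one-sided invariance to the two-sided condition that makes the
stabilizer a group. -/
theorem mem_formsStabilizer {q : ℕ} {V : Submodule F (⋀[F]^q Ω[F⁄k])} [FiniteDimensional F V]
    {g : FieldAut k F} (hg : ∀ ω ∈ V, actOnForms g q ω ∈ V) : g ∈ formsStabilizer V :=
  mem_iff_of_semilinear (MulSemiringAction.toRingEquiv _ F g) (formsEquiv g q)
    (actOnForms_smul g q) hg

theorem isOpen_formsStabilizer {q : ℕ} (V : Submodule F (⋀[F]^q Ω[F⁄k])) [FiniteDimensional F V] :
    IsOpen (formsStabilizer V : Set (FieldAut k F)) := by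
  classical
  obtain ⟨s, hs⟩ : V.FG := (Submodule.fg_iff_finiteDimensional V).2 inferInstance
  choose S hS using fun ω : ⋀[F]^q Ω[F⁄k] => exists_finset_fixing_form ω
  refine (isOpen_subgroup_iff _).2 ⟨s.biUnion S, fun g hg => mem_formsStabilizer fun ω hω => ?_⟩
  rw [← hs] at hω
  refine Submodule.span_induction (p := fun ω _ => actOnForms g q ω ∈ V) (fun ω hω => ?_)
    (by simp) (fun a b _ _ ha hb => ?_) (fun f a _ ha => ?_) hω
  · rw [hS ω g fun x hx => hg x (Finset.mem_biUnion.2 ⟨ω, hω, hx⟩), ← hs]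
    exact Submodule.subset_span hω
  · rw [map_add]
    exact add_mem ha hb
  · rw [actOnForms_smul]
    exact V.smul_mem _ ha

/-- The forms built from differentials in a subspace `L`. -/
noncomputable def formsOf (q : ℕ) (L : Submodule F (Ω[F⁄k])) : Submodule F (⋀[F]^q Ω[F⁄k]) :=
  LinearMap.range (exteriorPower.map q L.subtype)

theorem formsOf_mono {q : ℕ} {L L' : Submodule F (Ω[F⁄k])} (h : L ≤ L') :
    formsOf q L ≤ formsOf q L' := by
  rintro _ ⟨η, rfl⟩
  refine ⟨exteriorPower.map q (Submodule.inclusion h) η, ?_⟩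
  rw [← LinearMap.comp_apply, ← exteriorPower.map_comp, Submodule.subtype_comp_inclusion]

theorem exists_fg_mem_formsOf {q : ℕ} (ω : ⋀[F]^q Ω[F⁄k]) :
    ∃ L : Submodule F (Ω[F⁄k]), L.FG ∧ ω ∈ formsOf q L := by
  induction ω using forms_induction with
  | hι v =>
    refine ⟨Submodule.span F (Set.range v), Submodule.fg_span (Set.finite_range v),
      exteriorPower.ιMulti F q fun i => ⟨v i, Submodule.subset_span ⟨i, rfl⟩⟩, ?_⟩
    rw [exteriorPower.map_apply_ιMulti]
    rfl
  | hzero => exact ⟨⊥, Submodule.fg_bot, Submodule.zero_mem _⟩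
  | hadd a b ha hb =>
    obtain ⟨L, hL, ha⟩ := ha
    obtain ⟨L', hL', hb⟩ := hb
    exact ⟨L ⊔ L', hL.sup hL', add_mem (formsOf_mono le_sup_left ha) (formsOf_mono le_sup_right hb)⟩
  | hsmul f a ha =>
    obtain ⟨L, hL, ha⟩ := ha
    exact ⟨L, hL, Submodule.smul_mem _ _ ha⟩

theorem exists_fg_le_formsOf {q : ℕ} {V : Submodule F (⋀[F]^q Ω[F⁄k])} (hV : V.FG) :
    ∃ L : Submodule F (Ω[F⁄k]), L.FG ∧ V ≤ formsOf q L := by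
  obtain ⟨s, rfl⟩ := hV
  choose L hL hLs using fun ω : ⋀[F]^q Ω[F⁄k] => exists_fg_mem_formsOf ω
  refine ⟨s.sup L, Submodule.fg_finset_sup s L fun ω _ => hL ω, Submodule.span_le.2 fun ω hω => ?_⟩
  exact formsOf_mono (Finset.le_sup hω) (hLs ω)

/-- An automorphism moving `L` to a disjoint space moves the forms of positive degree built from `L`
to forms not built from `L`. -/
theorem eq_zero_of_actOnForms_mem_formsOf {q : ℕ} (hq : 1 ≤ q) {L : Submodule F (Ω[F⁄k])}
    {g : FieldAut k F} (hg : ∀ ω ∈ L, actOnDifferentials g ω ∈ L → ω = 0)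
    {ω : ⋀[F]^q Ω[F⁄k]} (hω : ω ∈ formsOf q L) (hgω : actOnForms g q ω ∈ formsOf q L) : ω = 0 := by
  -- This is the translate of `L` by `g`.
  let L' : Submodule F (Ω[F⁄k]) :=
    { carrier := {m | actOnDifferentials g⁻¹ m ∈ L}
      add_mem' := fun {a b} ha hb => by
        change actOnDifferentials g⁻¹ (a + b) ∈ L
        rw [map_add]
        exact add_mem ha hb
      zero_mem' := by
        change actOnDifferentials g⁻¹ 0 ∈ L
        rw [map_zero]
        exact L.zero_mem
      smul_mem' := fun c a ha => by
        change actOnDifferentials g⁻¹ (c • a) ∈ L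
        rw [actOnDifferentials_smul]
        exact L.smul_mem _ ha }
  have hL' (m : Ω[F⁄k]) (hm : m ∈ L) : actOnDifferentials g m ∈ L' := by
    change actOnDifferentials g⁻¹ (actOnDifferentials g m) ∈ L
    rwa [← actOnDifferentials_mul, inv_mul_cancel, actOnDifferentials_one]
  have hdisj (m : Ω[F⁄k]) (hm : m ∈ L) (hm' : m ∈ L') : m = 0 := by
    have h1 : actOnDifferentials g (actOnDifferentials g⁻¹ m) = m := by
      rw [← actOnDifferentials_mul, mul_inv_cancel, actOnDifferentials_one]
    rw [← h1, hg _ hm' (by rwa [h1]), map_zero]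
  obtain ⟨r, hr⟩ := LinearMap.exists_leftInverse_of_injective (L'.mkQ ∘ₗ L.subtype)
    (LinearMap.ker_eq_bot'.2 fun m hm => Subtype.ext (hdisj m m.2
      ((Submodule.Quotient.mk_eq_zero L').1 hm)))
  -- A projection onto `L` killing `L'`. Its exterior power is the identity on forms built from `L`
  -- and, as `q ≥ 1`, zero on forms built from `L'`; the translated form is of both kinds.
  let P : Ω[F⁄k] →ₗ[F] Ω[F⁄k] := L.subtype ∘ₗ r ∘ₗ L'.mkQ
  have hP : P ∘ₗ L.subtype = L.subtype := by
    rw [LinearMap.comp_assoc, LinearMap.comp_assoc, hr, LinearMap.comp_id]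
  have hP' (m : Ω[F⁄k]) (hm : m ∈ L') : P m = 0 := by
    change L.subtype (r (L'.mkQ m)) = 0
    rw [Submodule.mkQ_apply, (Submodule.Quotient.mk_eq_zero L').2 hm, map_zero, map_zero]
  have h1 : exteriorPower.map q P (actOnForms g q ω) = actOnForms g q ω := by
    obtain ⟨η, hη⟩ := hgω
    rw [← hη, ← LinearMap.comp_apply, ← exteriorPower.map_comp, hP]
  have h2 : exteriorPower.map q P (actOnForms g q ω) = 0 := by
    obtain ⟨η, rfl⟩ := hω
    clear h1 hgω
    induction η using forms_induction with
    | hι v =>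
      rw [exteriorPower.map_apply_ιMulti, actOnForms_ιMulti, exteriorPower.map_apply_ιMulti]
      exact (exteriorPower.ιMulti F q).map_coord_zero ⟨0, hq⟩ (hP' _ (hL' _ (v _).2))
    | hzero => simp only [map_zero]
    | hadd a b ha hb => simp only [map_add, ha, hb, add_zero]
    | hsmul f a ha => simp only [map_smul, actOnForms_smul, ha, smul_zero]
  refine (formsEquiv g q).injective ?_
  rw [map_zero]
  exact h1.symm.trans h2

/-- If `σ` lies in no proper open subgroup, it leaves no finite-dimensional space of forms of
positive degree invariant. -/
theorem not_exists_invariant_forms [CharZero k] [IsAlgClosed F]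
    (hF : Algebra.trdeg k F = Cardinal.aleph0) {σ : FieldAut k F} (hσ : σ ∉ properOpenUnion k F)
    {q : ℕ} (hq : 1 ≤ q) : ¬ ∃ V : Submodule F (⋀[F]^q Ω[F⁄k]), V ≠ ⊥ ∧ FiniteDimensional F V ∧
      ∀ ω ∈ V, actOnForms σ q ω ∈ V := by
  rintro ⟨V, hV, hfin, hinv⟩
  refine hσ ⟨formsStabilizer V, isOpen_formsStabilizer V, fun htop => hV ?_, mem_formsStabilizer hinv⟩
  -- If the stabilizer were everything it would contain a power of a shift moving `L` off itself,
  -- which leaves no room for a non-zero form in `V`.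
  obtain ⟨L, hL, hVL⟩ := exists_fg_le_formsOf ((Submodule.fg_iff_finiteDimensional V).2 hfin)
  obtain ⟨x, hx⟩ := Algebra.exists_isTranscendenceBasis_int (k := k) (D := k) hF (trdeg_lt_aleph0 k k)
  obtain ⟨τ, hτ⟩ := exists_shift hx
  obtain ⟨n, hn⟩ := hτ L L hL hL
  refine (Submodule.eq_bot_iff V).2 fun ω hω => ?_
  have hmem : τ ^ n ∈ formsStabilizer V := htop ▸ Subgroup.mem_top _
  exact eq_zero_of_actOnForms_mem_formsOf hq hn (hVL hω) (hVL ((hmem ω).2 hω))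

theorem oneEquiv_actOnForms (σ : FieldAut k F) (ω : ⋀[F]^1 Ω[F⁄k]) :
    exteriorPower.oneEquiv F _ (actOnForms σ 1 ω) =
      actOnDifferentials σ (exteriorPower.oneEquiv F _ ω) := by
  induction ω using forms_induction with
  | hι v => rw [actOnForms_ιMulti, exteriorPower.oneEquiv_ιMulti, exteriorPower.oneEquiv_ιMulti]
  | hzero => simp only [map_zero]
  | hadd a b ha hb => simp only [map_add, ha, hb]
  | hsmul f a ha => simp only [actOnForms_smul, map_smul, actOnDifferentials_smul, ha]

end Forms

/-! ### The union of the proper open subgroups -/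

section Differentials

variable {k F : Type*} [Field k] [Field F] [Algebra k F] [CharZero k]

theorem exists_D_ne_zero (h1 : 1 ≤ Algebra.trdeg k F) : ∃ x : F, D k F x ≠ 0 := by
  obtain ⟨s, hs⟩ := exists_isTranscendenceBasis k F
  obtain ⟨b, hb⟩ := hs.exists_basis_differentials
  obtain ⟨i⟩ : Nonempty s := Cardinal.mk_ne_zero_iff.1 fun h => by
    rw [← hs.cardinalMk_eq_trdeg, h] at h1
    exact absurd h1 (by simp)
  exact ⟨i, hb i ▸ b.ne_zero i⟩

theorem nontrivial_differentials (h1 : 1 ≤ Algebra.trdeg k F) : Nontrivial (Ω[F⁄k]) :=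
  let ⟨x, hx⟩ := exists_D_ne_zero h1
  ⟨D k F x, 0, hx⟩

theorem finiteDimensional_differentials (hF : Algebra.trdeg k F < Cardinal.aleph0) :
    FiniteDimensional F (Ω[F⁄k]) := by
  obtain ⟨s, hs⟩ := exists_isTranscendenceBasis k F
  obtain ⟨b, -⟩ := hs.exists_basis_differentials
  have : Finite s := Cardinal.lt_aleph0_iff_finite.1 (hs.cardinalMk_eq_trdeg ▸ hF)
  exact b.finiteDimensional_of_finite

/-- An automorphism leaving no non-zero finite-dimensional space of differentials invariant has
infinite order. -/
theorem orderOf_eq_zero_of_not_exists_invariant (h1 : 1 ≤ Algebra.trdeg k F)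
    {σ : FieldAut k F} (hσ : ¬ ∃ V : Submodule F (Ω[F⁄k]), V ≠ ⊥ ∧ FiniteDimensional F V ∧
      ∀ ω ∈ V, actOnDifferentials σ ω ∈ V) : orderOf σ = 0 := by
  by_contra hord
  have : Finite (Subgroup.zpowers σ) :=
    finite_zpowers.2 (orderOf_ne_zero_iff.1 hord)
  have := nontrivial_differentials h1
  obtain ⟨ω, hω⟩ := exists_ne (0 : Ω[F⁄k])
  let R : Set (Ω[F⁄k]) :=
    Set.range fun g : Subgroup.zpowers σ => actOnDifferentials (g : FieldAut k F) ω
  refine hσ ⟨Submodule.span F R, fun h => hω ?_, FiniteDimensional.span_of_finite F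
    (Set.finite_range _), fun η hη => ?_⟩
  · refine (Submodule.eq_bot_iff _).1 h ω (Submodule.subset_span ⟨1, ?_⟩)
    exact actOnDifferentials_one ω
  · refine Submodule.span_induction (p := fun η _ => actOnDifferentials σ η ∈ Submodule.span F R)
      ?_ (by simp) (fun a b _ _ ha hb => ?_) (fun f a _ ha => ?_) hη
    · rintro _ ⟨g, rfl⟩
      refine Submodule.subset_span ⟨⟨σ, Subgroup.mem_zpowers σ⟩ * g, ?_⟩
      exact actOnDifferentials_mul _ _ _
    · rw [map_add]
      exact add_mem ha hb
    · rw [actOnDifferentials_smul]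
      exact Submodule.smul_mem _ _ ha

variable [IsAlgClosed k] [IsAlgClosed F]

/-- Elements of proper open subgroups leave invariant a finite-dimensional space of differentials. -/
theorem exists_invariant_of_mem_properOpenUnion (h1 : 1 ≤ Algebra.trdeg k F)
    (hF : Algebra.trdeg k F ≤ Cardinal.aleph0) {σ : FieldAut k F} (hσ : σ ∈ properOpenUnion k F) :
    ∃ V : Submodule F (Ω[F⁄k]), V ≠ ⊥ ∧ FiniteDimensional F V ∧
      ∀ ω ∈ V, actOnDifferentials σ ω ∈ V := by
  rcases hF.lt_or_eq with hF | hF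
  · have := nontrivial_differentials h1
    have := finiteDimensional_differentials hF
    exact ⟨⊤, top_ne_bot, inferInstance, fun _ _ => trivial⟩
  · obtain ⟨U, hU, hne, hσU⟩ := hσ
    obtain ⟨W, hW, hfin, hinv⟩ := exists_invariant_of_isOpen hF hU hne
    exact ⟨W, hW, hfin, hinv σ hσU⟩

/-- If the transcendence degree is countably infinite, some automorphism lies in no proper open
subgroup. -/
theorem properOpenUnion_ne_univ (hF : Algebra.trdeg k F = Cardinal.aleph0) :
    properOpenUnion k F ≠ Set.univ := by
  intro huniv
  obtain ⟨x, hx⟩ := Algebra.exists_isTranscendenceBasis_int (k := k) (D := k) hF (trdeg_lt_aleph0 k k)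
  obtain ⟨σ, hσ⟩ := exists_shift hx
  obtain ⟨V, hV, hfin, hinv⟩ := exists_invariant_of_mem_properOpenUnion
    (hF ▸ Cardinal.one_le_aleph0) hF.le (huniv ▸ Set.mem_univ σ)
  have hfg := (Submodule.fg_iff_finiteDimensional V).2 hfin
  obtain ⟨n, hn⟩ := hσ V V hfg hfg
  refine hV ((Submodule.eq_bot_iff V).2 fun ω hω => hn ω hω ?_)
  clear hn
  induction n with
  | zero => rwa [pow_zero, actOnDifferentials_one]
  | succ n ih =>
    rw [pow_succ', actOnDifferentials_mul]
    exact hinv _ ih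

/-- If the transcendence degree is countably infinite, the union of the proper open subgroups is
dense. -/
theorem dense_properOpenUnion (hF : Algebra.trdeg k F = Cardinal.aleph0) :
    Dense (properOpenUnion k F) := by
  refine dense_iff_inter_open.2 fun O hO hne => ?_
  obtain ⟨g, hg⟩ := hne
  obtain ⟨S, hS⟩ := isOpen_iff.1 hO g hg
  obtain ⟨x, hx⟩ := exists_D_ne_zero (k := k) (F := F) (hF ▸ Cardinal.one_le_aleph0)
  -- The aim is an element of `O` fixing some `y` outside `k`. With `y` independent of `S` and of
  -- `gS`, some `h` fixes `S` and sends `y` to `g⁻¹y`; then `gh` agrees with `g` on `S` and fixes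
  -- `y`.
  obtain ⟨p, hp⟩ := exists_disjoint hF (Set.finite_singleton x)
    (S.finite_toSet.union (S.finite_toSet.smul_set (a := g)))
  rw [Set.smul_set_singleton] at hp
  let y := p • x
  have h1 : Disjoint (diffSpan k (S : Set F)) (diffSpan k {y}) :=
    hp.mono_left (diffSpan_mono Set.subset_union_left)
  have h2 : Disjoint (diffSpan k (S : Set F)) (diffSpan k (g⁻¹ • {y})) := by
    refine (disjoint_diffSpan_smul_iff (g := g)).1 ?_
    rw [smul_inv_smul]
    exact hp.mono_left (diffSpan_mono Set.subset_union_right)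
  obtain ⟨h, hhS, hhy⟩ := exists_fixing_of_disjoint hF S.finite_toSet (Set.finite_singleton y)
    g⁻¹ h1 h2
  refine ⟨g * h, hS _ fun x hx => by rw [mul_smul, hhS x hx],
    MulAction.stabilizer _ y, ?_, fun htop => ?_, ?_⟩
  · exact (isOpen_subgroup_iff _).2 ⟨{y}, fun h hh => hh y (Finset.mem_singleton_self y)⟩
  · obtain ⟨r, hr⟩ := exists_disjoint (k := k) hF (Set.finite_singleton y) (Set.finite_singleton y)
    have hry : r ∈ MulAction.stabilizer (FieldAut k F) y := htop ▸ Subgroup.mem_top r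
    rw [Set.smul_set_singleton, MulAction.mem_stabilizer_iff.1 hry, disjoint_self,
      Submodule.eq_bot_iff] at hr
    have hDy := hr _ (D_mem_diffSpan (Set.mem_singleton y))
    rw [← actOnDifferentials_D] at hDy
    exact hx (actOnDifferentials_injective p (hDy.trans (map_zero _).symm))
  · rw [MulAction.mem_stabilizer_iff, mul_smul, hhy y rfl, smul_inv_smul]

end Differentials

end FieldAut

/-! ### Smooth sets, representations and torsors -/

section Smooth

variable {G : Type*} [Group G] [TopologicalSpace G] [IsTopologicalGroup G]

/-- The coset space of an open subgroup is a smooth `G`-set. -/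
theorem isSmoothAction_quotient {U : Subgroup G} (hU : IsOpen (U : Set G)) :
    IsSmoothAction G (ULift.{w} (G ⧸ U)) := by
  rintro ⟨x⟩
  induction x using QuotientGroup.induction_on with
  | H g =>
    have : (MulAction.stabilizer G (ULift.up.{w} (g : G ⧸ U)) : Set G) =
        (fun h => g⁻¹ * h * g) ⁻¹' (U : Set G) := by
      ext h
      rw [SetLike.mem_coe, MulAction.mem_stabilizer_iff, ULift.ext_iff, ULift.smul_down, eq_comm]
      change (g : G ⧸ U) = ((h * g : G) : G ⧸ U) ↔ g⁻¹ * h * g ∈ U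
      rw [QuotientGroup.eq, mul_assoc]
    rw [this]
    exact hU.preimage (by fun_prop)

/-- The permutation representation on a smooth `G`-set is smooth. -/
theorem isSmoothRep_ofMulAction (E : Type*) [Field E] {X : Type*} [MulAction G X]
    (hX : IsSmoothAction G X) : IsSmoothRep (Representation.ofMulAction E G X) := by
  intro f
  let S : Subgroup G :=
    { carrier := {g | Representation.ofMulAction E G X g f = f}
      mul_mem' := fun {a b} ha hb => by
        change Representation.ofMulAction E G X (a * b) f = f
        rw [map_mul, Module.End.mul_apply, hb, ha]
      one_mem' := by
        change Representation.ofMulAction E G X 1 f = f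
        rw [map_one, Module.End.one_apply]
      inv_mem' := fun {a} ha => by
        change Representation.ofMulAction E G X a⁻¹ f = f
        nth_rewrite 1 [← ha]
        rw [← Module.End.mul_apply, ← map_mul, inv_mul_cancel, map_one, Module.End.one_apply] }
  let T : Subgroup G := ⨅ x : f.coeff.support, MulAction.stabilizer G (x : X)
  have hT : IsOpen (T : Set G) := by
    rw [Subgroup.coe_iInf]
    exact isOpen_iInter_of_finite fun x => hX x
  refine Subgroup.isOpen_mono (H₁ := T) (H₂ := S) (fun g hg => ?_) hT
  change Representation.ofMulAction E G X g f = f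
  have h : Finsupp.mapDomain (g • ·) f.coeff = f.coeff := by
    conv_rhs => rw [← Finsupp.mapDomain_id (v := f.coeff)]
    exact Finsupp.mapDomain_congr fun x hx => Subgroup.mem_iInf.1 hg ⟨x, hx⟩
  rw [Representation.ofMulAction_def]
  exact congrArg (MonoidAlgebra.coeffLinearEquiv E).symm h

end Smooth

namespace GroupTorsor

section Iso

variable {G : Type*} {M : Type*} [Group G] [TopologicalSpace G] [IsTopologicalGroup G] [Group M]
  [MulDistribMulAction G M]

/-- Isomorphisms of the restrictions to `⟨σ⟩` of smooth torsors are isomorphisms, if `σ` lies in no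
proper open subgroup. -/
theorem isIso_of_isIso_restrict {σ : G}
    (hσ : ∀ U : Subgroup G, IsOpen (U : Set G) → σ ∈ U → U = ⊤) {T T' : GroupTorsor G M}
    (hT : T.IsSmooth) (hT' : T'.IsSmooth)
    (h : (T.restrict (Subgroup.zpowers σ)).IsIso (T'.restrict (Subgroup.zpowers σ))) :
    T.IsIso T' := by
  obtain ⟨e, he, heM⟩ := h
  change T.carrier ≃ T'.carrier at e
  change ∀ (h : Subgroup.zpowers σ) (t : T.carrier), e ((h : G) • t) = (h : G) • e t at he
  change ∀ (m : M) (t : T.carrier), e (MulOpposite.op m • t) = MulOpposite.op m • e t at heM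
  let U : Subgroup G :=
    { carrier := {g | ∀ t, e (g • t) = g • e t}
      mul_mem' := fun {a b} ha hb t => by rw [mul_smul, ha, hb, mul_smul]
      one_mem' := fun t => by rw [one_smul, one_smul]
      inv_mem' := fun {a} ha t => by rw [eq_inv_smul_iff, ← ha, smul_inv_smul] }
  obtain ⟨t₀⟩ := T.nonempty
  have hU : IsOpen (U : Set G) := by
    -- Since `M` acts transitively and `e` respects its action, commuting with `g` need only be
    -- checked at `t₀`; it holds if `g` fixes both `t₀` and `e t₀`.
    refine Subgroup.isOpen_mono (H₁ := MulAction.stabilizer G t₀ ⊓ MulAction.stabilizer G (e t₀))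
      (fun g hg t => ?_) ((hT t₀).inter (hT' (e t₀)))
    obtain ⟨m, rfl, -⟩ := T.simplyTransitive t₀ t
    rw [T.smul_smul_op, hg.1, heM, heM, T'.smul_smul_op, hg.2]
  have htop := hσ U hU fun t => he ⟨σ, Subgroup.mem_zpowers σ⟩ t
  refine ⟨e, fun g => ?_, heM⟩
  have : g ∈ U := htop ▸ Subgroup.mem_top g
  exact this

end Iso

variable {H : Type v} {M : Type w} [Group H] [Group M] [MulDistribMulAction H M]

/-- For a trivial action of `H` on `M`, the torsor `M` with `H` acting through left multiplication
and a homomorphism to `M`. -/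
def ofHom (φ : H →* M) (hM : ∀ (h : H) (m : M), h • m = m) : GroupTorsor H M where
  carrier := M
  leftAction := MulAction.compHom M φ
  nonempty := ⟨1⟩
  smul_smul_op h t m := by
    rw [hM]
    exact (mul_assoc (φ h) t m).symm
  simplyTransitive := (trivial H M).simplyTransitive

end GroupTorsor

/-! ### Torsors under groups with trivial action -/

namespace FieldAut

section Torsors

variable {k F : Type*} [Field k] [Field F] [Algebra k F] [CharZero k] [IsAlgClosed k]
  [IsAlgClosed F]

/-- The automorphism group acts trivially on smooth torsors under groups with trivial action. -/
theorem smul_eq_of_isSmooth (hF : Algebra.trdeg k F = Cardinal.aleph0) {M : Type*} [Group M]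
    [MulDistribMulAction (FieldAut k F) M] (hM : ∀ (g : FieldAut k F) (m : M), g • m = m)
    {T : GroupTorsor (FieldAut k F) M} (hT : T.IsSmooth) (g : FieldAut k F) (t : T.carrier) :
    g • t = t := by
  have hfix (h : FieldAut k F) (hh : h • t = t) (t' : T.carrier) : h • t' = t' := by
    obtain ⟨m, rfl, -⟩ := T.simplyTransitive t t'
    rw [T.smul_smul_op, hM, hh]
  -- As the action on `M` is trivial, fixing one point means fixing all; the stabilizer is the
  -- kernel of the action.
  have hnormal : (MulAction.stabilizer (FieldAut k F) t).Normal := ⟨fun h hh p => by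
    rw [MulAction.mem_stabilizer_iff, mul_smul, mul_smul, hfix h hh, smul_inv_smul]⟩
  have : g ∈ MulAction.stabilizer (FieldAut k F) t :=
    eq_top_of_isOpen_of_normal hF (hT t) hnormal ▸ Subgroup.mem_top g
  exact this

/-- A homomorphism `⟨σ⟩ → M` sending `σ` to some `m ≠ 1` exists because `σ` has infinite order. In
the resulting torsor `σ` moves every point, whereas it acts trivially on every smooth torsor. -/
theorem not_surjOn_res (hF : Algebra.trdeg k F = Cardinal.aleph0) {σ : FieldAut k F}
    (hσ : orderOf σ = 0) {M : Type*} [Group M] [Nontrivial M]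
    [MulDistribMulAction (FieldAut k F) M] (hM : ∀ (g : FieldAut k F) (m : M), g • m = m) :
    ¬ Set.SurjOn (H1.res M (Subgroup.zpowers σ)) (H1Sm (FieldAut k F) M) Set.univ := by
  intro hsurj
  obtain ⟨m, hm⟩ := exists_ne (1 : M)
  let s : Subgroup.zpowers σ := ⟨σ, Subgroup.mem_zpowers σ⟩
  have hs : ∀ x, x ∈ Subgroup.zpowers s := by
    rintro ⟨_, n, rfl⟩
    exact ⟨n, rfl⟩
  have hord : orderOf m ∣ orderOf s := by
    rw [Subgroup.orderOf_mk, hσ]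
    exact dvd_zero _
  let φ : Subgroup.zpowers σ →* M := monoidHomOfForallMemZpowers hs hord
  have hφ : φ s = m := monoidHomOfForallMemZpowers_apply_gen hs hord
  obtain ⟨c, ⟨T, hT, rfl⟩, hc⟩ := hsurj (Set.mem_univ
    (Quotient.mk _ (GroupTorsor.ofHom φ fun h m => hM h m) : H1 (Subgroup.zpowers σ) M))
  obtain ⟨e, he, -⟩ := Quotient.exact hc
  obtain ⟨t⟩ := T.nonempty
  have h1 := he s t
  have h2 : (s • t : (T.restrict (Subgroup.zpowers σ)).carrier) = t :=
    smul_eq_of_isSmooth hF hM hT σ t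
  have h3 : (show M from e t) = φ s * (show M from e t) := (congrArg e h2).symm.trans h1
  rw [hφ] at h3
  exact hm (mul_eq_right.1 h3.symm)

end Torsors

/-! ### Fixed vectors and proper open subgroups -/

section Equivalences

variable {k : Type u} {F : Type v} [Field k] [Field F] [Algebra k F]

theorem eq_top_of_notMem_properOpenUnion {σ : FieldAut k F} (hσ : σ ∉ properOpenUnion k F)
    (U : Subgroup (FieldAut k F)) (hU : IsOpen (U : Set (FieldAut k F))) (hσU : σ ∈ U) : U = ⊤ :=
  by_contra fun h => hσ ⟨U, hU, h, hσU⟩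

theorem fixedPoints_eq_of_notMem_properOpenUnion {σ : FieldAut k F}
    (hσ : σ ∉ properOpenUnion k F) {W : Type*} [MulAction (FieldAut k F) W]
    (hW : IsSmoothAction (FieldAut k F) W) :
    MulAction.fixedPoints (Subgroup.zpowers σ) W = MulAction.fixedPoints (FieldAut k F) W := by
  refine Set.Subset.antisymm (fun x hx g => ?_) fun x hx g => hx g
  have : g ∈ MulAction.stabilizer (FieldAut k F) x :=
    eq_top_of_notMem_properOpenUnion hσ _ (hW x) (hx ⟨σ, Subgroup.mem_zpowers σ⟩) ▸
      Subgroup.mem_top g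
  exact this

theorem invariants_eq_of_notMem_properOpenUnion {σ : FieldAut k F}
    (hσ : σ ∉ properOpenUnion k F) {E W : Type*} [Field E] [AddCommGroup W] [Module E W]
    {ρ : Representation E (FieldAut k F) W} (hρ : IsSmoothRep ρ) :
    Representation.invariants (ρ.comp (Subgroup.zpowers σ).subtype) = ρ.invariants := by
  refine le_antisymm (fun x hx g => ?_) fun x hx g => hx g
  let U : Subgroup (FieldAut k F) :=
    { carrier := {g | ρ g x = x}
      mul_mem' := fun {a b} ha hb => by
        change ρ (a * b) x = x
        rw [map_mul, Module.End.mul_apply, hb, ha]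
      one_mem' := by
        change ρ 1 x = x
        rw [map_one, Module.End.one_apply]
      inv_mem' := fun {a} ha => by
        change ρ a⁻¹ x = x
        nth_rewrite 1 [← ha]
        rw [← Module.End.mul_apply, ← map_mul, inv_mul_cancel, map_one, Module.End.one_apply] }
  have : g ∈ U := eq_top_of_notMem_properOpenUnion hσ U (hρ x)
    (hx ⟨σ, Subgroup.mem_zpowers σ⟩) ▸ Subgroup.mem_top g
  exact this

theorem zpowers_smul_quotient {σ : FieldAut k F} {U : Subgroup (FieldAut k F)} (hσU : σ ∈ U)
    (g : Subgroup.zpowers σ) :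
    (g : FieldAut k F) • ULift.up.{w} ((1 : FieldAut k F) : FieldAut k F ⧸ U) =
      ULift.up ((1 : FieldAut k F) : FieldAut k F ⧸ U) := by
  refine ULift.ext _ _ ?_
  change (((g : FieldAut k F) * 1 : FieldAut k F) : FieldAut k F ⧸ U) = _
  rw [eq_comm, QuotientGroup.eq]
  simpa using (Subgroup.zpowers_le.2 hσU) g.2

theorem mem_of_smul_quotient {U : Subgroup (FieldAut k F)} {g : FieldAut k F}
    (h : g • ULift.up.{w} ((1 : FieldAut k F) : FieldAut k F ⧸ U) =
      ULift.up ((1 : FieldAut k F) : FieldAut k F ⧸ U)) : g ∈ U := by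
  have h' : ((g * 1 : FieldAut k F) : FieldAut k F ⧸ U) = ((1 : FieldAut k F) : FieldAut k F ⧸ U) :=
    congrArg ULift.down h
  rw [eq_comm, QuotientGroup.eq] at h'
  simpa using h'

/-- The base coset of `G ⧸ U` is fixed by `σ` whenever `σ ∈ U`, and by the whole group only if `U =
⊤`. The `ULift` places this set in the required universe. -/
theorem notMem_properOpenUnion_of_fixedPoints_eq {σ : FieldAut k F}
    (h : ∀ (W : Type (max v w)) [MulAction (FieldAut k F) W], IsSmoothAction (FieldAut k F) W →
      MulAction.fixedPoints (Subgroup.zpowers σ) W = MulAction.fixedPoints (FieldAut k F) W) :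
    σ ∉ properOpenUnion k F := by
  rintro ⟨U, hU, hne, hσU⟩
  refine hne (eq_top_iff.2 fun g _ => mem_of_smul_quotient.{u, v, w} ?_)
  have h' := h (ULift.{w} (FieldAut k F ⧸ U)) (isSmoothAction_quotient hU)
  exact (Set.ext_iff.1 h' _).1 (fun g => zpowers_smul_quotient hσU g) g

theorem notMem_properOpenUnion_of_invariants_eq {σ : FieldAut k F}
    (h : ∀ (W : Type (max v w)) [AddCommGroup W] [Module ℚ W]
      (ρ : Representation ℚ (FieldAut k F) W), IsSmoothRep ρ →
      Representation.invariants (ρ.comp (Subgroup.zpowers σ).subtype) = ρ.invariants) :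
    σ ∉ properOpenUnion k F := by
  rintro ⟨U, hU, hne, hσU⟩
  refine hne (eq_top_iff.2 fun g _ => mem_of_smul_quotient.{u, v, w} ?_)
  let x : ULift.{w} (FieldAut k F ⧸ U) := ULift.up ((1 : FieldAut k F) : FieldAut k F ⧸ U)
  have h' := h (MonoidAlgebra ℚ (ULift.{w} (FieldAut k F ⧸ U))) (Representation.ofMulAction ℚ _ _)
    (isSmoothRep_ofMulAction ℚ (isSmoothAction_quotient hU))
  have hx : MonoidAlgebra.single x (1 : ℚ) ∈
      (Representation.ofMulAction ℚ (FieldAut k F) (ULift.{w} (FieldAut k F ⧸ U))).invariants := by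
    rw [← h']
    intro g
    refine (Representation.ofMulAction_single _ _ _).trans ?_
    exact congrArg (MonoidAlgebra.single · (1 : ℚ)) (zpowers_smul_quotient hσU g)
  have hgx := hx g
  rw [Representation.ofMulAction_single] at hgx
  exact (MonoidAlgebra.single_left_inj one_ne_zero).1 hgx

end Equivalences

end FieldAut

/-! ### The main theorem -/

theorem corollary2p6 (k : Type u) (F : Type v) [Field k] [Field F] [Algebra k F]
    [CharZero k] [IsAlgClosed k] [IsAlgClosed F]
    (hn : 1 ≤ Algebra.trdeg k F) (hn' : Algebra.trdeg k F ≤ Cardinal.aleph0) :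
    (Algebra.trdeg k F = Cardinal.aleph0 →
      FieldAut.properOpenUnion k F ≠ Set.univ ∧ Dense (FieldAut.properOpenUnion k F)) ∧
    (∀ σ : FieldAut k F, List.TFAE [
      σ ∉ FieldAut.properOpenUnion k F,
      ∀ (W : Type (max v w)) [MulAction (FieldAut k F) W], IsSmoothAction (FieldAut k F) W →
        MulAction.fixedPoints (Subgroup.zpowers σ) W = MulAction.fixedPoints (FieldAut k F) W,
      ∀ (W : Type (max v w)) [AddCommGroup W] [Module ℚ W]
        (ρ : Representation ℚ (FieldAut k F) W), IsSmoothRep ρ →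
        Representation.invariants (ρ.comp (Subgroup.zpowers σ).subtype) = ρ.invariants,
      ∀ q : ℕ, 1 ≤ q → ¬ ∃ V : Submodule F (⋀[F]^q Ω[F⁄k]), V ≠ ⊥ ∧ FiniteDimensional F V ∧
        ∀ ω ∈ V, FieldAut.actOnForms σ q ω ∈ V,
      ¬ ∃ V : Submodule F (Ω[F⁄k]), V ≠ ⊥ ∧ FiniteDimensional F V ∧
        ∀ ω ∈ V, FieldAut.actOnDifferentials σ ω ∈ V]) ∧
    (∀ σ : FieldAut k F, σ ∉ FieldAut.properOpenUnion k F →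
      ∀ (M : Type w) [Group M] [MulDistribMulAction (FieldAut k F) M],
        IsSmoothAction (FieldAut k F) M →
        (∀ T : GroupTorsor (FieldAut k F) M, T.IsSmooth →
          ¬ T.IsIso (GroupTorsor.trivial (FieldAut k F) M) →
          ¬ (T.restrict (Subgroup.zpowers σ)).IsIso
            (GroupTorsor.trivial (Subgroup.zpowers σ) M)) ∧
        (∀ c ∈ H1Sm (FieldAut k F) M,
          H1.res M (Subgroup.zpowers σ) c = H1.base (Subgroup.zpowers σ) M ↔
            c = H1.base (FieldAut k F) M) ∧
        Set.InjOn (H1.res M (Subgroup.zpowers σ)) (H1Sm (FieldAut k F) M) ∧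
        (Nontrivial M → (∀ (g : FieldAut k F) (m : M), g • m = m) →
          ¬ Set.BijOn (H1.res M (Subgroup.zpowers σ)) (H1Sm (FieldAut k F) M) Set.univ)) := by
  have hinf {σ : FieldAut k F} (hσ : σ ∉ FieldAut.properOpenUnion k F) :
      Algebra.trdeg k F = Cardinal.aleph0 := by
    refine hn'.eq_of_not_lt fun hlt => hσ ?_
    rw [FieldAut.properOpenUnion_eq_univ hn hlt]
    trivial
  have htfae (σ : FieldAut k F) : List.TFAE [
      σ ∉ FieldAut.properOpenUnion k F,
      ∀ (W : Type (max v w)) [MulAction (FieldAut k F) W], IsSmoothAction (FieldAut k F) W →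
        MulAction.fixedPoints (Subgroup.zpowers σ) W = MulAction.fixedPoints (FieldAut k F) W,
      ∀ (W : Type (max v w)) [AddCommGroup W] [Module ℚ W]
        (ρ : Representation ℚ (FieldAut k F) W), IsSmoothRep ρ →
        Representation.invariants (ρ.comp (Subgroup.zpowers σ).subtype) = ρ.invariants,
      ∀ q : ℕ, 1 ≤ q → ¬ ∃ V : Submodule F (⋀[F]^q Ω[F⁄k]), V ≠ ⊥ ∧ FiniteDimensional F V ∧
        ∀ ω ∈ V, FieldAut.actOnForms σ q ω ∈ V,
      ¬ ∃ V : Submodule F (Ω[F⁄k]), V ≠ ⊥ ∧ FiniteDimensional F V ∧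
        ∀ ω ∈ V, FieldAut.actOnDifferentials σ ω ∈ V] := by
    tfae_have 1 → 2 := fun h W _ hW => FieldAut.fixedPoints_eq_of_notMem_properOpenUnion h hW
    tfae_have 2 → 1 := FieldAut.notMem_properOpenUnion_of_fixedPoints_eq.{u, v, w}
    tfae_have 1 → 3 := fun h W _ _ ρ hρ => FieldAut.invariants_eq_of_notMem_properOpenUnion h hρ
    tfae_have 3 → 1 := FieldAut.notMem_properOpenUnion_of_invariants_eq.{u, v, w}
    tfae_have 1 → 4 := fun h q hq => FieldAut.not_exists_invariant_forms (hinf h) h hq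
    tfae_have 4 → 5 := by
      rintro h ⟨V, hV, hfin, hinv⟩
      let e := exteriorPower.oneEquiv F (Ω[F⁄k])
      refine h 1 le_rfl ⟨V.comap e.toLinearMap, fun hbot => hV ?_, ?_, fun ω hω => ?_⟩
      · refine (Submodule.eq_bot_iff V).2 fun ω hω => ?_
        have := (Submodule.eq_bot_iff _).1 hbot (e.symm ω) (by simpa using hω)
        simpa using this
      · exact Submodule.map_equiv_eq_comap_symm e.symm V ▸ Module.Finite.map V e.symm.toLinearMap
      · rw [Submodule.mem_comap] at hω ⊢
        exact FieldAut.oneEquiv_actOnForms σ ω ▸ hinv _ hω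
    tfae_have 5 → 1 := fun h hσ =>
      h (FieldAut.exists_invariant_of_mem_properOpenUnion hn hn' hσ)
    tfae_finish
  refine ⟨fun hF => ⟨FieldAut.properOpenUnion_ne_univ hF, FieldAut.dense_properOpenUnion hF⟩,
    htfae, fun σ hσ M _ _ hM => ?_⟩
  have hiso {T T' : GroupTorsor (FieldAut k F) M} (hT : T.IsSmooth) (hT' : T'.IsSmooth) :=
    GroupTorsor.isIso_of_isIso_restrict
      (FieldAut.eq_top_of_notMem_properOpenUnion hσ) hT hT'
  have htriv : (GroupTorsor.trivial (FieldAut k F) M).IsSmooth := hM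
  have hinj : Set.InjOn (H1.res M (Subgroup.zpowers σ)) (H1Sm (FieldAut k F) M) := by
    rintro _ ⟨T, hT, rfl⟩ _ ⟨T', hT', rfl⟩ h
    exact Quotient.sound (hiso hT hT' (Quotient.exact h))
  refine ⟨fun T hT hne h => hne (hiso hT htriv h), fun c hc => ⟨fun h => ?_, ?_⟩, hinj,
    fun _ htrivial hbij => ?_⟩
  · exact hinj hc ⟨_, htriv, rfl⟩ h
  · rintro rfl
    -- Restricting the trivial torsor gives the trivial torsor definitionally.
    rfl
  · exact FieldAut.not_surjOn_res (hinf hσ)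
      (FieldAut.orderOf_eq_zero_of_not_exists_invariant hn (((htfae σ).out 0 4).1 hσ))
      htrivial hbij.surjOn
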